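/- **Setting.** Let $I$ and $O$ be finite disjoint sets of input and output propositions and $\Sigma=2^{I\cup O}$. A transition system $T=(S,s_0,\tau)$ has a transition function $\tau:S\times 2^I\to S\times 2^O$; its size is $|T|=|S|$, its traces are the words $(\iota_0\cup o_0)(\iota_1\cup o_1)\cdots$ with $\tau(s_i,\iota_i)=(s_{i+1},o_i)$ for all $i$, and $T\models\chi$ means that all traces of $T$ satisfy the LTL formula $\chi$. For an LTL formula $\psi$ let $\mathrm{val}(T,G\psi)$ be $(1,1,1)$ if $T\models G\psi$; otherwise $(1,1,0)$ if $T\models FG\psi$; otherwise $(1,0,0)$ if $T\models GF\psi$; otherwise $(0,0,0)$. Let $\mathrm{val}(T,G\varphi_1\wedge\dots\wedge G\varphi_n)$ be the componentwise sum of the $\mathrm{val}(T,G\varphi_j)$; these values are compared lexicographically. The run graph of an automaton $(Q,q_0,\delta,F)$ on $T$ has nodes $S\times Q$ and an edge $((s,q),\sigma,(s',q'))$ whenever $(q,\sigma,q')\in\delta$ and $\tau(s,\sigma\cap I)=(s',\sigma\cap O)$. A universal co-Büchi automaton accepts $T$ if every infinite path from $(s_0,q_0)$ visits $F$ only finitely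 often; it is an automaton *for* $\chi$ if it accepts exactly the finite-state $T$ with $T\models\chi$. **Automata.** Let $\varphi,\varphi_1,\dots,\varphi_n$ be LTL formulas over $I\cup O$ and let all automata have finite state sets. Let $A=(Q,q_0,\delta,F)$ be a universal co-Büchi automaton for $\varphi$ and $A_j=(\widehat Q_j,\widehat q_0^j,\widehat\delta_j,\widehat F_j)$ one for $GF\varphi_j$. Let $N_j$ be a nondeterministic finite-word automaton that accepts only bad prefixes of $\varphi_j$ (words none of whose infinite extensions satisfies $\varphi_j$) and at least one prefix of each word violating $\varphi_j$, whose initial state is not accepting and has a transition for each letter. (Such $N_j$ exists whenever $\varphi_j$ is syntactically safe.) Let $B_j=\mathrm{Relax}_{FG}(G\varphi_j)$ be built from $N_j$ as follows: merge the accepting states into one sink $\mathrm{rej}$; add a self-loop at the initial state for each letter with a transition from the initial state to a state other than $\mathrm{rej}$; then redirect all transitions from other states to $\mathrm{rej}$ to the initial state, and delete $\mathrm{rej}$. The redirected transitions form the set $\mathrm{Rej}(B_j)$. Write $q_0^j$ for the initial state of $B_j$. **Encoding.** For a bound $b\ge1$ let $S=\{1,\dots,b\}$ with $s_0=1$. The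 Boolean variables are $\tau_{s,\iota,s'}$ and $o_{s,\iota}$ ($s,s'\in S$, $\iota\in2^I$, $o\in O$) and, for each of the automata $A$, $B_j$, $A_j$, variables $\lambda^{\mathbb B}_{s,q}$ and a bit vector $\lambda^{\#}_{s,q}$ for each state $q$ of it, written $\lambda$, $\mu^j$, $\lambda^j$ respectively; the bit vectors are just long enough to write the numbers up to $b|F|$, $b$, $b|\widehat F_j|$ respectively. The hard constraints are: 1. for all $s,\iota$ some $\tau_{s,\iota,s'}$ holds; 2. $\lambda^{\mathbb B}_{s_0,q_0}$ holds; 3. for each of these automata and all $s,s',q,q',\iota$: if $\lambda^{\mathbb B}_{s,q}$ and $\tau_{s,\iota,s'}$ hold and $(q,\sigma,q')$ is a transition, where $\sigma$ is the letter consisting of $\iota$ and of the outputs $o$ with $o_{s,\iota}$ true, then $\lambda^{\mathbb B}_{s',q'}$ holds and $\lambda^{\#}_{s',q'}\ge\lambda^{\#}_{s,q}$, with strict inequality if $q'$ is rejecting (for $A$ and $A_j$), respectively if $(q,\sigma,q')\in\mathrm{Rej}(B_j)$ (for $B_j$) (with $\mu^j$, $\lambda^j$ in place of $\lambda$ for $B_j$,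 $A_j$); 4. $\mu^{j,\#}_{s,q}\le b$ for all $j,s,q$. The soft constraints are, for each $j$: $\mu^{j,\mathbb B}_{s_0,q_0^j}\wedge(\mu^{j,\#}_{s_0,q_0^j}=b)$ with weight $1$; $\mu^{j,\mathbb B}_{s_0,q_0^j}$ with weight $n$; and $\mu^{j,\mathbb B}_{s_0,q_0^j}\vee\lambda^{j,\mathbb B}_{s_0,\widehat q_0^j}$ with weight $n^2$. An assignment is optimal if it satisfies all hard constraints and maximizes the total weight of the satisfied soft constraints among the assignments that do so. **Theorem.** The hard constraints are satisfiable if and only if there is a transition system $T$ with $|T|\le b$ and $T\models\varphi$, and in that case an optimal assignment exists. From every optimal assignment one can extract, using only the values of the variables $\tau_{s,\iota,s'}$ and $o_{s,\iota}$, a transition system $T^*$ with state set $S$ and initial state $s_0$ (on input $\iota$ in state $s$, move to some $s'$ for which $\tau_{s,\iota,s'}$ is true, and output $\{o\mid o_{s,\iota}\text{ is true}\}$). Every transition system $T^*$ so extracted satisfies $T^*\models\varphi$, and $$\mathrm{val}(T^*,G\varphi_1\wedge\dots\wedge G\varphi_n)\ \ge\ \mathrm{val}(T,G\varphi_1\wedge\dots\wedge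 G\varphi_n)$$ for every transition system $T$ with $|T|\le b$ and $T\models\varphi$. -/

import Mathlib

noncomputable section

/-! Linear temporal logic -/

/-- LTL formulas over a set `P` of atomic propositions. -/
inductive LTL (P : Type*) where
  | atom (p : P)
  | tru
  | fls
  | not (f : LTL P)
  | and (f g : LTL P)
  | or (f g : LTL P)
  | next (f : LTL P)
  | untl (f g : LTL P)
  | release (f g : LTL P)

namespace LTL

variable {P : Type*}

/-- `F f = true U f`. -/
def finally_ (f : LTL P) : LTL P := untl tru f

/-- `G f = false R f`. -/
def globally (f : LTL P) : LTL P := release fls f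

/-- The suffix of an infinite word that starts at position `k`. -/
def suffix (w : ℕ → Set P) (k : ℕ) : ℕ → Set P := fun i => w (k + i)

/-- Satisfaction of a formula by an infinite word over the alphabet `2^P`. -/
def Sat : (ℕ → Set P) → LTL P → Prop
  | w, atom p => p ∈ w 0
  | _, tru => True
  | _, fls => False
  | w, not f => ¬ Sat w f
  | w, and f g => Sat w f ∧ Sat w g
  | w, or f g => Sat w f ∨ Sat w g
  | w, next f => Sat (suffix w 1) f
  | w, untl f g => ∃ k, Sat (suffix w k) g ∧ ∀ i, i < k → Sat (suffix w i) f
  | w, release f g => ∀ k, Sat (suffix w k) g ∨ ∃ i, i < k ∧ Sat (suffix w i) f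

end LTL

/-! Transition systems -/

section Systems

variable {I O : Type*}

/-- Letters: valuations of the disjoint union of input and output propositions. -/
abbrev Letter (I O : Type*) := Set (I ⊕ O)

/-- Projection of a letter to the input propositions. -/
def Letter.inp (x : Letter I O) : Set I := {p | Sum.inl p ∈ x}

/-- Projection of a letter to the output propositions. -/
def Letter.out (x : Letter I O) : Set O := {p | Sum.inr p ∈ x}

/-- The letter consisting of an input valuation and an output valuation. -/
def Letter.mk (i : Set I) (o : Set O) : Letter I O := Sum.inl '' i ∪ Sum.inr '' o

/-- Transition systems with state set `S`. -/
structure TransitionSystem (I O S : Type*) where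
  init : S
  step : S → Set I → S × Set O

/-- The traces of a transition system: the label sequences of its executions. -/
def TransitionSystem.Traces {S : Type*} (T : TransitionSystem I O S) :
    Set (ℕ → Letter I O) :=
  {w | ∃ s : ℕ → S, s 0 = T.init ∧
    ∀ i, T.step (s i) (w i).inp = (s (i + 1), (w i).out)}

/-- `T ⊨ f`: every trace of `T` satisfies `f`. -/
def TransitionSystem.Models {S : Type*} (T : TransitionSystem I O S) (f : LTL (I ⊕ O)) : Prop :=
  ∀ w ∈ T.Traces, LTL.Sat w f

open Classical in
/-- The value of `G f` in `T`. -/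
def TransitionSystem.val {S : Type*} (T : TransitionSystem I O S) (f : LTL (I ⊕ O)) :
    ℕ × ℕ × ℕ :=
  if T.Models f.globally then (1, 1, 1)
  else if T.Models f.globally.finally_ then (1, 1, 0)
  else if T.Models f.finally_.globally then (1, 0, 0)
  else (0, 0, 0)

/-- The value of `G f₁ ∧ … ∧ G fₙ` in `T`: the componentwise sum, with the lexicographic order. -/
def TransitionSystem.valAll {S : Type*} {n : ℕ} (T : TransitionSystem I O S)
    (f : Fin n → LTL (I ⊕ O)) : ℕ ×ₗ (ℕ ×ₗ ℕ) :=
  toLex (∑ j, (T.val (f j)).1, toLex (∑ j, (T.val (f j)).2.1, ∑ j, (T.val (f j)).2.2))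

end Systems

/-! Automata -/

/-- The tuple `(Q, q₀, δ, F)`; it is read below as a finite-word automaton or as a universal
co-Büchi automaton. -/
structure Automaton (A Q : Type*) where
  init : Q
  trans : Set (Q × A × Q)
  final : Set Q

/-- The word `v` followed by the infinite word `w`. -/
def appendWord {A : Type*} (v : List A) (w : ℕ → A) : ℕ → A :=
  fun i => if h : i < v.length then v[i] else w (i - v.length)

/-- Acceptance of a finite word by a nondeterministic finite-word automaton. -/
def Automaton.AcceptsFinite {A Q : Type*} (N : Automaton A Q) (v : List A) : Prop :=
  ∃ r : ℕ → Q, r 0 = N.init ∧ (∀ i, ∀ h : i < v.length, (r i, v[i], r (i + 1)) ∈ N.trans) ∧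
    r v.length ∈ N.final

/-- `N` accepts only bad prefixes of `f`, and at least one prefix of each word violating `f`. -/
def Automaton.DetectsBadPrefixes {P Q : Type*} (N : Automaton (Set P) Q) (f : LTL P) : Prop :=
  (∀ v, N.AcceptsFinite v → ∀ w, ¬ LTL.Sat (appendWord v w) f) ∧
  (∀ w, ¬ LTL.Sat w f → ∃ k, N.AcceptsFinite ((List.range k).map w))

section RunGraph

variable {I O Q S : Type*}

/-- The labelled edges of the run graph of `A` on `T`; its nodes are the elements of `S × Q`. -/
def Automaton.runEdge (A : Automaton (Letter I O) Q) (T : TransitionSystem I O S)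
    (x : S × Q) (l : Letter I O) (y : S × Q) : Prop :=
  (x.2, l, y.2) ∈ A.trans ∧ T.step x.1 l.inp = (y.1, l.out)

/-- Acceptance of `T` by the universal co-Büchi automaton `A`: every infinite path of the run
graph that starts in the initial node visits rejecting states only finitely often. -/
def Automaton.CoBuchiAccepts (A : Automaton (Letter I O) Q) (T : TransitionSystem I O S) : Prop :=
  ∀ p : ℕ → S × Q, p 0 = (T.init, A.init) → (∀ i, ∃ l, A.runEdge T (p i) l (p (i + 1))) →
    {i | (p i).2 ∈ A.final}.Finite

/-- `A` is a universal co-Büchi automaton for `f`: it accepts exactly the (finite-state)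
transition systems that satisfy `f`. -/
def Automaton.IsCoBuchiFor (A : Automaton (Letter I O) Q) (f : LTL (I ⊕ O)) : Prop :=
  ∀ (S : Type) [Fintype S] (T : TransitionSystem I O S), A.CoBuchiAccepts T ↔ T.Models f

end RunGraph

section Relax

variable {A Q : Type*}

/-- The non-accepting states of `N`. -/
abbrev Automaton.Live (N : Automaton A Q) := {q : Q // q ∉ N.final}

/-- The universal Büchi automaton for `f`, from an automaton `N` detecting bad prefixes of `f`:
the accepting states of `N` are merged into one rejecting sink `none`. -/
def Automaton.safeAut (N : Automaton A Q) (h : N.init ∉ N.final) :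
    Automaton A (Option N.Live) where
  init := some ⟨N.init, h⟩
  trans := {t | ∃ (q q' : N.Live) (l : A), (q.1, l, q'.1) ∈ N.trans ∧ t = (some q, l, some q')} ∪
    {t | ∃ (q : N.Live) (l : A), (∃ q' ∈ N.final, (q.1, l, q') ∈ N.trans) ∧
      t = (some q, l, none)} ∪
    {t | ∃ l : A, t = (none, l, none)}
  final := {q | q ≠ none}

/-- The universal Büchi automaton for `G f`: self-loops are added at the initial state for all
letters with a transition from the initial state not leading to the sink. -/
def Automaton.globAut (N : Automaton A Q) (h : N.init ∉ N.final) :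
    Automaton A (Option N.Live) where
  init := (N.safeAut h).init
  trans := (N.safeAut h).trans ∪
    {t | ∃ l : A, (∃ q', q' ≠ none ∧ ((N.safeAut h).init, l, q') ∈ (N.safeAut h).trans) ∧
      t = ((N.safeAut h).init, l, (N.safeAut h).init)}
  final := (N.safeAut h).final

/-- The automaton `Relax_FG(G f)`: the sink is removed from the automaton for `G f`, and the
transitions leading to the sink are redirected to the initial state. -/
def Automaton.relaxFG (N : Automaton A Q) (h : N.init ∉ N.final) : Automaton A N.Live where
  init := ⟨N.init, h⟩
  trans := {t | (some t.1, t.2.1, some t.2.2) ∈ (N.globAut h).trans} ∪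
    {t | t.2.2 = ⟨N.init, h⟩ ∧ (some t.1, t.2.1, none) ∈ (N.globAut h).trans}
  final := Set.univ

/-- The transitions of `Relax_FG(G f)` that stem from transitions leading to the sink. -/
def Automaton.relaxRej (N : Automaton A Q) (h : N.init ∉ N.final) :
    Set (N.Live × A × N.Live) :=
  {t | t ∈ (N.relaxFG h).trans ∧ t.2.2 = ⟨N.init, h⟩ ∧
    (some t.1, t.2.1, none) ∈ (N.safeAut h).trans}

end Relax

/-! Propositional constraints and partial weighted MaxSAT -/

/-- Propositional formulas over the Boolean variables `V`. -/
inductive PForm (V : Type*) where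
  | var (v : V)
  | tru
  | neg (f : PForm V)
  | and (f g : PForm V)
  | or (f g : PForm V)

namespace PForm

variable {V : Type*} {ι : Type*}

/-- Truth under an assignment. -/
def Holds (a : V → Bool) : PForm V → Prop
  | var v => a v = true
  | tru => True
  | neg f => ¬ Holds a f
  | and f g => Holds a f ∧ Holds a g
  | or f g => Holds a f ∨ Holds a g

def fls : PForm V := neg tru

def imp (f g : PForm V) : PForm V := or (neg f) g

def iff (f g : PForm V) : PForm V := and (imp f g) (imp g f)

/-- Finite conjunction. -/
def bigAnd (s : Finset ι) (f : ι → PForm V) : PForm V := (s.toList.map f).foldr and tru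

/-- Finite disjunction. -/
def bigOr (s : Finset ι) (f : ι → PForm V) : PForm V := (s.toList.map f).foldr or fls

/-- Strict comparison `y < x` of numbers in binary; bit `k` has weight `2 ^ k`. -/
def bitsGt {K : ℕ} (x y : Fin K → PForm V) : PForm V :=
  bigOr Finset.univ fun k => and (and (x k) (neg (y k)))
    (bigAnd (Finset.univ.filter fun l => k < l) fun l => iff (x l) (y l))

/-- Comparison `y ≤ x` of numbers in binary. -/
def bitsGe {K : ℕ} (x y : Fin K → PForm V) : PForm V := neg (bitsGt y x)

/-- The `K` lowest bits of the number `c`. -/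
def constBits (K c : ℕ) : Fin K → PForm V := fun k => if c.testBit k then tru else fls

/-- The number `x` equals the constant `c` (for `c < 2 ^ K`). -/
def bitsEqConst {K : ℕ} (x : Fin K → PForm V) (c : ℕ) : PForm V :=
  bigAnd Finset.univ fun k => iff (x k) (constBits K c k)

end PForm

/-- A partial weighted MaxSAT instance: hard constraints and weighted soft constraints. -/
structure MaxSAT (V : Type*) where
  hard : List (PForm V)
  soft : List (PForm V × ℕ)

namespace MaxSAT

variable {V : Type*}

/-- The assignment satisfies all hard constraints. -/
def Feasible (M : MaxSAT V) (a : V → Bool) : Prop := ∀ f ∈ M.hard, f.Holds a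

open Classical in
/-- The sum of the weights of the satisfied soft constraints. -/
def weight (M : MaxSAT V) (a : V → Bool) : ℕ :=
  (M.soft.map fun c => if c.1.Holds a then c.2 else 0).sum

/-- Optimal assignments: feasible ones of maximal weight. -/
def IsOptimal (M : MaxSAT V) (a : V → Bool) : Prop :=
  M.Feasible a ∧ ∀ a', M.Feasible a' → M.weight a' ≤ M.weight a

end MaxSAT

/-! The encoding -/

/-- The Boolean variables of the encoding for the state set `Fin b`. `c` is the bound on the
numbers `λ(s,q)` and `d j` the one on the numbers of the `j`-th co-Büchi automaton; `Nat.size m`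
is the number of bits needed to write the numbers `0, …, m`. -/
inductive EncVar (I O Q : Type*) {n : ℕ} (R H : Fin n → Type*) (b c : ℕ) (d : Fin n → ℕ) where
  | tau (s : Fin b) (i : Set I) (s' : Fin b)
  | out (o : O) (s : Fin b) (i : Set I)
  | hardB (s : Fin b) (q : Q)
  | hardN (s : Fin b) (q : Q) (k : Fin (Nat.size c))
  | fgB (j : Fin n) (s : Fin b) (q : R j)
  | fgN (j : Fin n) (s : Fin b) (q : R j) (k : Fin (Nat.size b))
  | gfB (j : Fin n) (s : Fin b) (q : H j)
  | gfN (j : Fin n) (s : Fin b) (q : H j) (k : Fin (Nat.size (d j)))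

section Constraints

variable {I O V : Type*} [Fintype I] [Fintype O] {b : ℕ}

open Classical in
/-- The formula over the variables `o_{s,i}` saying that `l` is in the set `L` of letters, where `l`
is the letter consisting of the input `i` and of the output of `s` on `i`. -/
def letterForm (out : O → Fin b → Set I → V) (L : Set (Letter I O)) (s : Fin b) (i : Set I) :
    PForm V :=
  PForm.bigOr (Finset.univ.filter fun o : Set O => Letter.mk i o ∈ L) fun o =>
    PForm.bigAnd Finset.univ fun p =>
      if p ∈ o then PForm.var (out p s i) else PForm.neg (PForm.var (out p s i))

/-- The formula `δ_{s,q,i,q'}` for a transition relation (or a set of transitions) `D`. -/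
def deltaForm {Q : Type*} (out : O → Fin b → Set I → V) (D : Set (Q × Letter I O × Q))
    (s : Fin b) (q : Q) (i : Set I) (q' : Q) : PForm V :=
  letterForm out {l | (q, l, q') ∈ D} s i

/-- Input-enabledness. -/
def tauConstraint (tau : Fin b → Set I → Fin b → V) : PForm V :=
  PForm.bigAnd Finset.univ fun s => PForm.bigAnd Finset.univ fun i =>
    PForm.bigOr Finset.univ fun s' => PForm.var (tau s i s')

/-- The implications
`(λB(s,q) ∧ δ_{s,q,i,q'} ∧ τ_{s,i,s'}) → succ(s,q,s',q',i)` for all `q, q', s, s', i`. -/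
def edgeConstraint {Q : Type*} [Fintype Q] (tau : Fin b → Set I → Fin b → V)
    (out : O → Fin b → Set I → V) (D : Set (Q × Letter I O × Q)) (lamB : Fin b → Q → V)
    (succ : Fin b → Q → Fin b → Q → Set I → PForm V) : PForm V :=
  PForm.bigAnd Finset.univ fun q => PForm.bigAnd Finset.univ fun q' =>
    PForm.bigAnd Finset.univ fun s => PForm.bigAnd Finset.univ fun s' =>
      PForm.bigAnd Finset.univ fun i =>
        PForm.imp
          (PForm.and (PForm.and (PForm.var (lamB s q)) (deltaForm out D s q i q'))
            (PForm.var (tau s i s')))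
          (succ s q s' q' i)

open Classical in
/-- The successor condition for a co-Büchi automaton with rejecting states `F`. -/
def succCoBuchi {Q : Type*} {K : ℕ} (F : Set Q) (lamB : Fin b → Q → V)
    (lamN : Fin b → Q → Fin K → V) (s : Fin b) (q : Q) (s' : Fin b) (q' : Q) : PForm V :=
  PForm.and (PForm.var (lamB s' q'))
    (if q' ∈ F then PForm.bitsGt (fun k => .var (lamN s' q' k)) (fun k => .var (lamN s q k))
     else PForm.bitsGe (fun k => .var (lamN s' q' k)) (fun k => .var (lamN s q k)))

/-- The successor condition for `Relax_FG`, with set `R` of rejecting transitions. -/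
def succFG {Q : Type*} {K : ℕ} (out : O → Fin b → Set I → V) (R : Set (Q × Letter I O × Q))
    (lamB : Fin b → Q → V) (lamN : Fin b → Q → Fin K → V)
    (s : Fin b) (q : Q) (s' : Fin b) (q' : Q) (i : Set I) : PForm V :=
  PForm.and (PForm.var (lamB s' q'))
    (PForm.and
      (PForm.imp (deltaForm out R s q i q')
        (PForm.bitsGt (fun k => .var (lamN s' q' k)) (fun k => .var (lamN s q k))))
      (PForm.imp (PForm.neg (deltaForm out R s q i q'))
        (PForm.bitsGe (fun k => .var (lamN s' q' k)) (fun k => .var (lamN s q k)))))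

/-- All numbers `λN(s,q)` are at most `c`. -/
def boundConstraint {Q : Type*} [Fintype Q] {K : ℕ} (lamN : Fin b → Q → Fin K → V) (c : ℕ) :
    PForm V :=
  PForm.bigAnd Finset.univ fun s => PForm.bigAnd Finset.univ fun q =>
    PForm.bitsGe (PForm.constBits K c) (fun k => .var (lamN s q k))

end Constraints

section Encoding

variable {I O Q : Type*} [Fintype I] [Fintype O] [Fintype Q] {n : ℕ}
  {QN QH : Fin n → Type*} [∀ j, Fintype (QN j)] [∀ j, Fintype (QH j)]

/-- The variables of the encoding for the given automata and the bound `b`. -/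
abbrev MRVar (A : Automaton (Letter I O) Q) (N : ∀ j, Automaton (Letter I O) (QN j))
    (H : ∀ j, Automaton (Letter I O) (QH j)) (b : ℕ) :=
  EncVar I O Q (fun j => (N j).Live) QH b (b * A.final.ncard) (fun j => b * (H j).final.ncard)

open Classical in
/-- The MaxSAT instance of bounded maximum realizability for the bound `b`. `A` is the automaton
for the hard specification; the `j`-th soft specification is given by an automaton `N j` detecting
bad prefixes, from which `Relax_FG` is built, and a co-Büchi automaton `H j`. -/
def mrEncoding (A : Automaton (Letter I O) Q) (N : ∀ j, Automaton (Letter I O) (QN j))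
    (hN : ∀ j, (N j).init ∉ (N j).final) (H : ∀ j, Automaton (Letter I O) (QH j))
    (b : ℕ) [NeZero b] : MaxSAT (MRVar A N H b) where
  hard :=
    [tauConstraint (fun s i s' => .tau s i s'),
      .and (.var (.hardB 0 A.init))
        (edgeConstraint (fun s i s' => .tau s i s') (fun o s i => .out o s i) A.trans
          (fun s q => .hardB s q)
          (fun s q s' q' _ => succCoBuchi A.final (fun s q => .hardB s q)
            (fun s q k => .hardN s q k) s q s' q'))] ++
    (List.finRange n).map (fun j =>
      edgeConstraint (fun s i s' => .tau s i s') (fun o s i => .out o s i)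
        ((N j).relaxFG (hN j)).trans (fun s q => .fgB j s q)
        (succFG (fun o s i => .out o s i) ((N j).relaxRej (hN j)) (fun s q => .fgB j s q)
          (fun s q k => .fgN j s q k))) ++
    (List.finRange n).map (fun j => boundConstraint (fun s q k => .fgN j s q k) b) ++
    (List.finRange n).map (fun j =>
      edgeConstraint (fun s i s' => .tau s i s') (fun o s i => .out o s i) (H j).trans
        (fun s q => .gfB j s q)
        (fun s q s' q' _ => succCoBuchi (H j).final (fun s q => .gfB j s q)
          (fun s q k => .gfN j s q k) s q s' q'))
  soft :=
    (List.finRange n).flatMap fun j =>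
      [(.and (.var (.fgB j 0 ((N j).relaxFG (hN j)).init))
          (PForm.bitsEqConst (fun k => .var (.fgN j 0 ((N j).relaxFG (hN j)).init k)) b), 1),
        (.var (.fgB j 0 ((N j).relaxFG (hN j)).init), n),
        (.or (.var (.fgB j 0 ((N j).relaxFG (hN j)).init)) (.var (.gfB j 0 (H j).init)), n ^ 2)]

/-- `T` is a transition system extracted from the values of the variables `τ_{s,i,s'}` and
`o_{s,i}`: each successor is one that `τ` offers, and the outputs are the ones given by `o`. -/
def Extracted {A : Automaton (Letter I O) Q} {N : ∀ j, Automaton (Letter I O) (QN j)}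
    {H : ∀ j, Automaton (Letter I O) (QH j)} {b : ℕ} [NeZero b]
    (a : MRVar A N H b → Bool) (T : TransitionSystem I O (Fin b)) : Prop :=
  T.init = 0 ∧ ∀ (s : Fin b) (i : Set I),
    a (.tau s i (T.step s i).1) = true ∧ (T.step s i).2 = {o | a (.out o s i) = true}

end Encoding

end

/-! Assignments satisfying the hard constraints encode rankings of run graphs (`IsRanking`): numbers
on an edge-closed set of nodes that never decrease along edges and increase along rejecting ones. A
soft constraint rewards such a ranking for covering the initial node, and so for claiming a
relaxation. The theorem combines two estimates on these claims.

Soundness (`models_of_feasible`): every claim is true in every extracted system. Bounded ranks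
increase only finitely often along a path, which settles the co-Büchi automata. In `Relax_FG` the
initial state can be kept along a whole trace. For each violation, a run of the bad-prefix automaton
starts at the violation and returns to the initial state by a rejecting transition, so the rank of
the initial state grows. Hence violations are finite in number, and there are none if the rank
starts at its maximum `b`.

Completeness (`exists_feasible_of_models`): each system satisfying `φ` admits an assignment claiming
all relaxations it satisfies. The rank of a node is the number of marked nodes leading to it, the
targets of rejecting transitions being marked. It increases along a rejecting edge unless that edge
lies on a cycle. A reachable such cycle yields a path with infinitely many rejecting transitions,
contradicting acceptance or, in `Relax_FG`, the property `FG`. Counting marked nodes gives the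
bounds `b|F|` and `b`. Under `G` no rejecting edge is reachable, so the constant rank `b` works.

Thus the weight of an optimal assignment lies between the weighted value of any competing system and
that of any extracted one. The weights `n²`, `n`, `1` turn this into the lexicographic comparison
(`lex_le_of_weight_le`). -/

open Relation

/-! ### Binary numbers in propositional formulas -/

namespace PForm

variable {V ι : Type*} (a : V → Bool)

@[simp] theorem holds_bigAnd (s : Finset ι) (f : ι → PForm V) :
    (bigAnd s f).Holds a ↔ ∀ i ∈ s, (f i).Holds a := by
  have key : ∀ l : List ι, ((l.map f).foldr and tru).Holds a ↔ ∀ i ∈ l, (f i).Holds a := by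
    intro l
    induction l with
    | nil => simp [Holds]
    | cons x l ih => simp [Holds, ih]
  simp [bigAnd, key]

@[simp] theorem holds_bigOr (s : Finset ι) (f : ι → PForm V) :
    (bigOr s f).Holds a ↔ ∃ i ∈ s, (f i).Holds a := by
  have key : ∀ l : List ι, ((l.map f).foldr or fls).Holds a ↔ ∃ i ∈ l, (f i).Holds a := by
    intro l
    induction l with
    | nil => simp [Holds, fls]
    | cons x l ih => simp [Holds, ih]
  simp [bigOr, key]

@[simp] theorem holds_imp (f g : PForm V) : (imp f g).Holds a ↔ (f.Holds a → g.Holds a) := by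
  simp only [imp, Holds]; tauto

@[simp] theorem holds_iff (f g : PForm V) : (iff f g).Holds a ↔ (f.Holds a ↔ g.Holds a) := by
  simp only [iff, Holds, holds_imp]; tauto

open Classical in
/-- The number whose binary digits are the truth values of the given formulas. -/
noncomputable def number {K : ℕ} (x : Fin K → PForm V) : ℕ :=
  Nat.ofBits fun k => decide ((x k).Holds a)

theorem number_lt {K : ℕ} (x : Fin K → PForm V) : number a x < 2 ^ K := Nat.ofBits_lt_two_pow _

theorem testBit_number {K : ℕ} (x : Fin K → PForm V) (k : Fin K) :
    (number a x).testBit k = true ↔ (x k).Holds a := by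
  simp [number, Nat.testBit_ofBits_lt]

theorem testBit_number_of_le {K : ℕ} (x : Fin K → PForm V) {k : ℕ} (hk : K ≤ k) :
    (number a x).testBit k = false := by
  simp [number, Nat.testBit_ofBits_ge _ _ hk]

theorem number_eq {K : ℕ} (x : Fin K → PForm V) {m : ℕ} (hm : m < 2 ^ K)
    (h : ∀ k : Fin K, (x k).Holds a ↔ m.testBit k = true) : number a x = m := by
  apply Nat.eq_of_testBit_eq
  intro k
  by_cases hk : k < K
  · have := testBit_number a x ⟨k, hk⟩
    rw [h] at this
    exact Bool.eq_iff_iff.2 this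
  · rw [testBit_number_of_le a x (by omega), eq_comm]
    exact Nat.testBit_lt_two_pow (hm.trans_le (Nat.pow_le_pow_right (by norm_num) (by omega)))

theorem number_constBits {K c : ℕ} (hc : c < 2 ^ K) :
    number a (constBits K c : Fin K → PForm V) = c :=
  number_eq a _ hc fun k => by
    unfold constBits
    split_ifs with h <;> simp [Holds, fls, h]

theorem holds_bitsGt {K : ℕ} (x y : Fin K → PForm V) :
    (bitsGt x y).Holds a ↔ number a y < number a x := by
  simp only [bitsGt, holds_bigOr, Holds, holds_bigAnd, holds_iff, Finset.mem_univ, true_and,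
    Finset.mem_filter, ← testBit_number]
  constructor
  · rintro ⟨k, ⟨hx, hy⟩, h⟩
    refine Nat.lt_of_testBit k (by simpa using hy) hx fun l hl => ?_
    by_cases hlK : l < K
    · exact (Bool.eq_iff_iff.2 (h ⟨l, hlK⟩ hl)).symm
    · rw [testBit_number_of_le a x (by omega), testBit_number_of_le a y (by omega)]
  · intro hlt
    -- The top bit of the exclusive or is the highest position where the numbers differ, and it
    -- decides the comparison.
    have hne : number a x ^^^ number a y ≠ 0 := by
      rw [Ne, Nat.xor_eq_zero_iff]
      omega
    obtain ⟨k, hk, hmax⟩ := Nat.exists_most_significant_bit hne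
    have hagree : ∀ l, k < l → (number a x).testBit l = (number a y).testBit l := by
      intro l hl
      have := hmax l hl
      rw [Nat.testBit_xor] at this
      simpa using this
    rw [Nat.testBit_xor] at hk
    have hkK : k < K := by
      by_contra hc
      rw [testBit_number_of_le a x (by omega), testBit_number_of_le a y (by omega)] at hk
      simp at hk
    cases hx : (number a x).testBit k
    · have hy : (number a y).testBit k = true := by simpa [hx] using hk
      exact absurd (Nat.lt_of_testBit k hx hy hagree) (by omega)
    · have hy : (number a y).testBit k = false := by simpa [hx] using hk
      exact ⟨⟨k, hkK⟩, ⟨hx, by simp [hy]⟩, fun l hl => by rw [hagree l hl]⟩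

theorem holds_bitsGe {K : ℕ} (x y : Fin K → PForm V) :
    (bitsGe x y).Holds a ↔ number a y ≤ number a x := by
  simp [bitsGe, Holds, holds_bitsGt]

theorem holds_bitsEqConst {K c : ℕ} (x : Fin K → PForm V) (hc : c < 2 ^ K) :
    (bitsEqConst x c).Holds a ↔ number a x = c := by
  have hconst : ∀ k : Fin K, (constBits K c k : PForm V).Holds a ↔ c.testBit k = true := by
    intro k
    rw [← testBit_number, number_constBits a hc]
  simp only [bitsEqConst, holds_bigAnd, holds_iff, Finset.mem_univ, true_imp_iff, hconst]
  refine ⟨number_eq a x hc, fun h k => ?_⟩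
  rw [← testBit_number, h]

end PForm

theorem Nat.lt_two_pow_size_of_le {m c : ℕ} (h : m ≤ c) : m < 2 ^ Nat.size c :=
  h.trans_lt (Nat.lt_size_self c)

/-! ### Temporal operators in terms of suffixes -/

namespace LTL

variable {P : Type*}

theorem suffix_suffix (w : ℕ → Set P) (k l : ℕ) : suffix (suffix w k) l = suffix w (k + l) := by
  funext i
  simp [suffix, Nat.add_assoc]

theorem sat_globally (w : ℕ → Set P) (f : LTL P) :
    Sat w f.globally ↔ ∀ k, Sat (suffix w k) f := by
  simp [globally, Sat]

theorem sat_finally (w : ℕ → Set P) (f : LTL P) :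
    Sat w f.finally_ ↔ ∃ k, Sat (suffix w k) f := by
  simp [finally_, Sat]

theorem sat_finally_globally (w : ℕ → Set P) (f : LTL P) :
    Sat w f.globally.finally_ ↔ ∃ k, ∀ l, k ≤ l → Sat (suffix w l) f := by
  simp only [sat_finally, sat_globally, suffix_suffix]
  refine exists_congr fun k => ⟨fun h l hl => ?_, fun h l => h _ (by omega)⟩
  simpa [Nat.add_sub_cancel' hl] using h (l - k)

theorem sat_globally_finally (w : ℕ → Set P) (f : LTL P) :
    Sat w f.finally_.globally ↔ ∀ k, ∃ l, k ≤ l ∧ Sat (suffix w l) f := by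
  simp only [sat_finally, sat_globally, suffix_suffix]
  refine forall_congr' fun k => ⟨fun ⟨l, h⟩ => ⟨k + l, by omega, h⟩, fun ⟨l, hl, h⟩ => ⟨l - k, ?_⟩⟩
  rwa [Nat.add_sub_cancel' hl]

end LTL

/-! ### Traces and values of transition systems -/

section Systems

variable {I O S : Type*}

@[simp] theorem Letter.inp_mk (i : Set I) (o : Set O) : (Letter.mk i o).inp = i := by
  ext; simp [Letter.inp, Letter.mk]

@[simp] theorem Letter.out_mk (i : Set I) (o : Set O) : (Letter.mk i o).out = o := by
  ext; simp [Letter.out, Letter.mk]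

@[simp] theorem Letter.mk_inp_out (l : Letter I O) : Letter.mk l.inp l.out = l := by
  ext x; cases x <;> simp [Letter.inp, Letter.out, Letter.mk]

namespace TransitionSystem

variable (T : TransitionSystem I O S)

theorem Models.finally_globally {T : TransitionSystem I O S} {f : LTL (I ⊕ O)}
    (h : T.Models f.globally) : T.Models f.globally.finally_ := fun w hw =>
  (LTL.sat_finally_globally w f).2 ⟨0, fun l _ => (LTL.sat_globally w f).1 (h w hw) l⟩

theorem Models.globally_finally {T : TransitionSystem I O S} {f : LTL (I ⊕ O)}
    (h : T.Models f.globally.finally_) : T.Models f.finally_.globally := fun w hw => by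
  obtain ⟨k, hk⟩ := (LTL.sat_finally_globally w f).1 (h w hw)
  exact (LTL.sat_globally_finally w f).2 fun m => ⟨max m k, le_max_left _ _, hk _ (le_max_right _ _)⟩

open Classical in
-- Since `G` implies `FG` and `FG` implies `GF`, the nested case distinction splits into three
-- independent indicators.
theorem val_eq (f : LTL (I ⊕ O)) :
    T.val f = (if T.Models f.finally_.globally then 1 else 0,
      if T.Models f.globally.finally_ then 1 else 0, if T.Models f.globally then 1 else 0) := by
  have h₁ : T.Models f.globally → T.Models f.globally.finally_ := Models.finally_globally
  have h₂ : T.Models f.globally.finally_ → T.Models f.finally_.globally := Models.globally_finally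
  unfold val
  by_cases h : T.Models f.globally
  · simp [h, h₁ h, h₂ (h₁ h)]
  · by_cases h' : T.Models f.globally.finally_
    · simp [h, h', h₂ h']
    · by_cases h'' : T.Models f.finally_.globally <;> simp [h, h', h'']

theorem val_congr {S' : Type*} {T : TransitionSystem I O S} {T' : TransitionSystem I O S'}
    (h : T.Traces = T'.Traces) (f : LTL (I ⊕ O)) : T.val f = T'.val f := by
  have key : T.Models = T'.Models := by
    funext g
    simp [Models, h]
  rw [val_eq, val_eq, key]

/-- The run of `T` on a sequence of inputs. -/
def run (ι : ℕ → Set I) : ℕ → S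
  | 0 => T.init
  | i + 1 => (T.step (run ι i) (ι i)).1

/-- The trace of `T` on a sequence of inputs. -/
def traceOf (ι : ℕ → Set I) (i : ℕ) : Letter I O :=
  Letter.mk (ι i) (T.step (T.run ι i) (ι i)).2

theorem traceOf_mem (ι : ℕ → Set I) : T.traceOf ι ∈ T.Traces :=
  ⟨T.run ι, rfl, fun i => by simp [traceOf, run]⟩

/-- A system with at most `b` states has the same traces as one with state set `Fin b`. -/
theorem exists_fin_traces_eq [Fintype S] {b : ℕ} [NeZero b] (hb : Fintype.card S ≤ b) :
    ∃ T' : TransitionSystem I O (Fin b), T'.init = 0 ∧ T'.Traces = T.Traces := by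
  obtain ⟨e₀⟩ : Nonempty (S ↪ Fin b) :=
    Function.Embedding.nonempty_of_card_le (by simpa using hb)
  -- The swap moves the image of the initial state to `0`.
  let e : S ↪ Fin b := e₀.trans (Equiv.swap (e₀ T.init) 0).toEmbedding
  have he : e T.init = 0 := by simp [e]
  have : Nonempty S := ⟨T.init⟩
  have hinv : ∀ s, Function.invFun e (e s) = s := Function.leftInverse_invFun e.injective
  -- Outside the range of `e` the value of `invFun` is arbitrary; those states are never visited, as
  -- every step lands in the range.
  refine ⟨⟨0, fun s i => (e (T.step (Function.invFun e s) i).1,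
    (T.step (Function.invFun e s) i).2)⟩, rfl, ?_⟩
  ext w
  constructor
  · rintro ⟨s, hs, h⟩
    refine ⟨fun i => Function.invFun e (s i), ?_, fun i => ?_⟩
    · simp only [hs, ← he, hinv]
    · have := Prod.ext_iff.1 (h i)
      simp only at this
      exact Prod.ext (by simp only [← this.1, hinv]) this.2
  · rintro ⟨s, hs, h⟩
    exact ⟨fun i => e (s i), by simp [hs, he], fun i => by simp [hinv, h i]⟩

end TransitionSystem

end Systems

/-! ### Lassos and ranks in graphs -/

/-- A lasso: if the edge from `v` to `v'` is reachable from `x₀` and lies on a cycle, some infinite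
path from `x₀` takes it infinitely often. -/
theorem exists_path_through_edge {X : Type*} {E : X → X → Prop} {x₀ v v' : X}
    (h₀ : ReflTransGen E x₀ v) (hE : E v v') (hback : ReflTransGen E v' v) :
    ∃ p : ℕ → X, p 0 = x₀ ∧ (∀ i, E (p i) (p (i + 1))) ∧
      ∀ k, ∃ i, k ≤ i ∧ p i = v ∧ p (i + 1) = v' := by
  classical
  have hstep : ∃ (d : X → ℕ) (next : X → X), ∀ x, ReflTransGen E x v →
      E x (next x) ∧ ReflTransGen E (next x) v ∧ (x = v → next x = v') ∧
        (x ≠ v → d (next x) < d x) := by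
    -- `R n x` means that a walk of exactly `n` edges leads from `x` to `v`. The least such `n` is
    -- the distance `d x`; the path descends along it to `v`, then takes the edge to `v'` and starts
    -- over.
    let R : ℕ → X → Prop := fun n => Nat.rec (fun x => x = v) (fun _ r x => ∃ y, E x y ∧ r y) n
    have hR : ∀ x, ReflTransGen E x v → ∃ n, R n x := by
      intro x hx
      induction hx using ReflTransGen.head_induction_on with
      | refl => exact ⟨0, rfl⟩
      | head hxy _ ih =>
        obtain ⟨n, hn⟩ := ih
        exact ⟨n + 1, _, hxy, hn⟩
    have hR' : ∀ n x, R n x → ReflTransGen E x v := by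
      intro n
      induction n with
      | zero => intro x hx; rw [show x = v from hx]
      | succ n ih =>
        rintro x ⟨y, hxy, hy⟩
        exact (ih y hy).head hxy
    let d : X → ℕ := fun x => sInf {n | R n x}
    have hnext : ∀ x, ∃ y, ReflTransGen E x v →
        E x y ∧ ReflTransGen E y v ∧ (x = v → y = v') ∧ (x ≠ v → d y < d x) := by
      intro x
      by_cases hx : ReflTransGen E x v
      · by_cases hxv : x = v
        · subst hxv
          exact ⟨v', fun _ => ⟨hE, hback, fun _ => rfl, fun h => absurd rfl h⟩⟩
        · have hd : R (d x) x := Nat.sInf_mem (hR x hx)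
          cases hdx : d x with
          | zero => rw [hdx] at hd; exact absurd hd hxv
          | succ n =>
            rw [hdx] at hd
            obtain ⟨y, hxy, hy⟩ := hd
            exact ⟨y, fun _ => ⟨hxy, hR' n y hy, fun h => absurd h hxv,
              fun _ => Nat.lt_succ_of_le (Nat.sInf_le hy)⟩⟩
      · exact ⟨x, fun h => absurd h hx⟩
    choose next hnext using hnext
    exact ⟨d, next, hnext⟩
  obtain ⟨d, next, hnext⟩ := hstep
  let p : ℕ → X := fun i => next^[i] x₀
  have hp : ∀ i, p (i + 1) = next (p i) := fun i => Function.iterate_succ_apply' next i x₀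
  have hreach : ∀ i, ReflTransGen E (p i) v := by
    intro i
    induction i with
    | zero => exact h₀
    | succ i ih => rw [hp]; exact (hnext _ ih).2.1
  refine ⟨p, rfl, fun i => by rw [hp]; exact (hnext _ (hreach i)).1, fun k => ?_⟩
  have key : ∀ n k, d (p k) = n → ∃ i, k ≤ i ∧ p i = v := by
    intro n
    induction n using Nat.strong_induction_on with
    | _ n ih =>
      intro k hk
      by_cases hv : p k = v
      · exact ⟨k, le_rfl, hv⟩
      · have hlt := (hnext _ (hreach k)).2.2.2 hv
        rw [← hp, hk] at hlt
        obtain ⟨i, hi, h⟩ := ih _ hlt (k + 1) rfl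
        exact ⟨i, by omega, h⟩
  obtain ⟨i, hi, h⟩ := key _ k rfl
  exact ⟨i, hi, h, by rw [hp]; exact (hnext _ (hreach i)).2.2.1 h⟩

section Rank

variable {X : Type*} [Finite X] (E : X → X → Prop) (M : Set X)

/-- The number of marked nodes from which `v` can be reached. -/
noncomputable def markedRank (v : X) : ℕ := {u ∈ M | ReflTransGen E u v}.ncard

theorem markedRank_le_ncard (v : X) : markedRank E M v ≤ M.ncard :=
  Set.ncard_le_ncard (fun _ h => h.1) (Set.toFinite _)

variable {E M}

theorem markedRank_mono {v v' : X} (h : E v v') : markedRank E M v ≤ markedRank E M v' :=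
  Set.ncard_le_ncard (fun _ hu => ⟨hu.1, hu.2.tail h⟩) (Set.toFinite _)

/-- The marked node `v'` counts for itself but not for `v`, because no path leads back. -/
theorem markedRank_lt {v v' : X} (h : E v v') (hM : v' ∈ M) (hback : ¬ ReflTransGen E v' v) :
    markedRank E M v < markedRank E M v' :=
  Set.ncard_lt_ncard ⟨fun _ hu => ⟨hu.1, hu.2.tail h⟩, fun hsub =>
    hback (hsub (show v' ∈ _ from ⟨hM, .refl⟩)).2⟩ (Set.toFinite _)

end Rank

/-- A monotone function is injective on the places where it increases strictly, and its values there
lie in the finite interval up to `c`. -/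
theorem finite_setOf_lt_succ {f : ℕ → ℕ} {c : ℕ} (hf : Monotone f) (hc : ∀ i, f i ≤ c) :
    {i | f i < f (i + 1)}.Finite := by
  refine Set.Finite.of_finite_image ((Set.finite_Iic c).subset ?_) (f := f) ?_
  · rintro _ ⟨i, -, rfl⟩
    exact hc i
  · have key : ∀ i j, f i < f (i + 1) → i < j → f i < f j := fun i j hi hij =>
      hi.trans_le (hf hij)
    intro i hi j hj hij
    rcases lt_trichotomy i j with h | h | h
    · exact absurd hij (key i j hi h).ne
    · exact h
    · exact absurd hij (key j i hj h).ne'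

/-! ### Rankings and co-Büchi acceptance -/

section Ranking

variable {I O S Q : Type*}

/-- A ranking of the run graph of an automaton with transitions `D` on `T`: `B` is closed under
edges, and `f` does not decrease along the edges in `B` and increases along those in `R`. -/
def IsRanking (T : TransitionSystem I O S) (D R : Set (Q × Letter I O × Q))
    (B : S → Q → Prop) (f : S → Q → ℕ) : Prop :=
  ∀ s q l s' q', B s q → (q, l, q') ∈ D → T.step s l.inp = (s', l.out) →
    B s' q' ∧ f s q ≤ f s' q' ∧ ((q, l, q') ∈ R → f s q < f s' q')

/-- The annotation that claims nothing, for relaxations that a system does not satisfy. -/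
theorem isRanking_false (T : TransitionSystem I O S) (D R : Set (Q × Letter I O × Q)) :
    IsRanking T D R (fun _ _ => False) (fun _ _ => 0) :=
  fun _ _ _ _ _ h => h.elim

/-- The edge relation of the run graph of an automaton with transitions `D` on `T`. -/
def runStep (T : TransitionSystem I O S) (D : Set (Q × Letter I O × Q)) (x y : S × Q) : Prop :=
  ∃ l : Letter I O, (x.2, l, y.2) ∈ D ∧ T.step x.1 l.inp = (y.1, l.out)

/-- If no reachable edge labelled by a transition in `R` lies on a cycle and all of these lead to
`M`, the numbers of nodes in `M` leading to a node form a ranking. -/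
theorem isRanking_markedRank [Finite S] [Finite Q] (T : TransitionSystem I O S)
    (D R : Set (Q × Letter I O × Q)) (M : Set (S × Q)) (x₀ : S × Q)
    (hM : ∀ q l q' s', (q, l, q') ∈ D → (q, l, q') ∈ R → (s', q') ∈ M)
    (hcyc : ∀ s q l s' q', (q, l, q') ∈ D → (q, l, q') ∈ R → T.step s l.inp = (s', l.out) →
      ReflTransGen (runStep T D) x₀ (s, q) → ¬ ReflTransGen (runStep T D) (s', q') (s, q)) :
    IsRanking T D R (fun s q => ReflTransGen (runStep T D) x₀ (s, q))
      (fun s q => markedRank (runStep T D) M (s, q)) := by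
  intro s q l s' q' hB hD hT
  have hE : runStep T D (s, q) (s', q') := ⟨l, hD, hT⟩
  exact ⟨hB.tail hE, markedRank_mono hE, fun hR =>
    markedRank_lt hE (hM _ _ _ _ hD hR) (hcyc _ _ _ _ _ hD hR hT hB)⟩

/-- The transitions of a co-Büchi automaton that lead to rejecting states. -/
def Automaton.rejecting {L : Type*} (A : Automaton L Q) : Set (Q × L × Q) :=
  {t | t.2.2 ∈ A.final}

theorem Automaton.coBuchiAccepts_of_isRanking (A : Automaton (Letter I O) Q)
    {T : TransitionSystem I O S} {B : S → Q → Prop} {f : S → Q → ℕ} {c : ℕ}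
    (h : IsRanking T A.trans A.rejecting B f) (hB : B T.init A.init) (hc : ∀ s q, f s q ≤ c) :
    A.CoBuchiAccepts T := by
  intro p hp0 hp
  have hBp : ∀ i, B (p i).1 (p i).2 := by
    intro i
    induction i with
    | zero => rw [hp0]; exact hB
    | succ i ih =>
      obtain ⟨l, hl, hT⟩ := hp i
      exact (h _ _ _ _ _ ih hl hT).1
  have hmono : Monotone fun i => f (p i).1 (p i).2 := monotone_nat_of_le_succ fun i => by
    obtain ⟨l, hl, hT⟩ := hp i
    exact (h _ _ _ _ _ (hBp i) hl hT).2.1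
  -- A visit to a rejecting state at time `i + 1` comes with an increase at `i`; only time `0` has
  -- no incoming edge and is added separately.
  refine (((finite_setOf_lt_succ hmono fun i => hc _ _).image Nat.succ).insert 0).subset ?_
  rintro (_ | i) hi
  · exact Or.inl rfl
  · obtain ⟨l, hl, hT⟩ := hp i
    exact Or.inr ⟨i, (h _ _ _ _ _ (hBp i) hl hT).2.2 hi, rfl⟩

/-- The marked nodes are `S × F`. A rejecting edge on a reachable cycle would give a path that
visits `F` infinitely often. -/
theorem Automaton.CoBuchiAccepts.exists_isRanking [Fintype S] [Fintype Q]
    {A : Automaton (Letter I O) Q} {T : TransitionSystem I O S} (h : A.CoBuchiAccepts T) :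
    ∃ (B : S → Q → Prop) (f : S → Q → ℕ), IsRanking T A.trans A.rejecting B f ∧
      (∀ s q, f s q ≤ Fintype.card S * A.final.ncard) ∧ B T.init A.init := by
  refine ⟨_, _, isRanking_markedRank T A.trans A.rejecting (Set.univ ×ˢ A.final)
    (T.init, A.init) (fun q l q' s' _ hR => ⟨trivial, hR⟩) ?_, fun s q => ?_, .refl⟩
  · intro s q l s' q' hD hR hT hreach hback
    obtain ⟨p, hp0, hp, hinf⟩ := exists_path_through_edge hreach ⟨l, hD, hT⟩ hback
    have hfin := h p hp0 fun i => by
      obtain ⟨l, hl⟩ := hp i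
      exact ⟨l, hl⟩
    obtain ⟨m, hm⟩ := hfin.bddAbove
    obtain ⟨i, hi, -, hi'⟩ := hinf m
    have : i + 1 ≤ m := hm (show (p (i + 1)).2 ∈ A.final by rw [hi']; exact hR)
    omega
  · refine (markedRank_le_ncard _ _ _).trans_eq ?_
    rw [Set.ncard_prod, Set.ncard_univ, Nat.card_eq_fintype_card]

end Ranking

/-! ### Bad prefixes and the automaton `Relax_FG` -/

theorem appendWord_suffix {P : Type*} (w : ℕ → Set P) (k : ℕ) :
    appendWord ((List.range k).map w) (LTL.suffix w k) = w := by
  funext i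
  unfold appendWord LTL.suffix
  split_ifs with h
  · simp
  · simp only [List.length_map, List.length_range, not_lt] at h ⊢
    rw [Nat.add_sub_cancel' h]

theorem exists_path_of_reflTransGen {I O S Q : Type*} {T : TransitionSystem I O S}
    {D : Set (Q × Letter I O × Q)} {x₀ x : S × Q} (h : ReflTransGen (runStep T D) x₀ x) :
    ∃ (n : ℕ) (p : ℕ → S × Q) (w : ℕ → Letter I O), p 0 = x₀ ∧ p n = x ∧
      ∀ i, i < n → ((p i).2, w i, (p (i + 1)).2) ∈ D ∧
        T.step (p i).1 (w i).inp = ((p (i + 1)).1, (w i).out) := by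
  induction h with
  | refl => exact ⟨0, fun _ => x₀, fun _ => ∅, rfl, rfl, fun i hi => absurd hi (by omega)⟩
  | @tail y z _ hyz ih =>
    obtain ⟨n, p, w, hp0, hpn, hp⟩ := ih
    obtain ⟨l, hl⟩ := hyz
    refine ⟨n + 1, fun i => if i ≤ n then p i else z, fun i => if i < n then w i else l,
      by simp [hp0], by simp, fun i hi => ?_⟩
    rcases Nat.lt_succ_iff_lt_or_eq.1 hi with hi | rfl
    · simp only [hi, hi.le, Nat.succ_le_of_lt hi, if_true]
      exact hp i hi
    · simp only [le_rfl, lt_irrefl, Nat.not_succ_le_self, if_true, if_false, hpn]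
      exact hl

namespace Automaton

variable {L Q : Type*}

theorem acceptsFinite_map_range (N : Automaton L Q) (w : ℕ → L) (k : ℕ) :
    N.AcceptsFinite ((List.range k).map w) ↔
      ∃ r : ℕ → Q, r 0 = N.init ∧ (∀ i, i < k → (r i, w i, r (i + 1)) ∈ N.trans) ∧
        r k ∈ N.final := by
  simp [AcceptsFinite]

section Relax

variable (N : Automaton L Q) (h : N.init ∉ N.final)

theorem mem_safeAut_trans_some (q q' : N.Live) (l : L) :
    (some q, l, some q') ∈ (N.safeAut h).trans ↔ (q.1, l, q'.1) ∈ N.trans := by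
  simp only [safeAut, Set.mem_union, Set.mem_ofPred_eq, Prod.mk.injEq, Option.some.injEq,
    reduceCtorEq, and_false, exists_false, or_false]
  constructor
  · rintro ⟨_, _, _, h, rfl, rfl, rfl⟩
    exact h
  · exact fun h => ⟨q, q', l, h, rfl, rfl, rfl⟩

theorem mem_safeAut_trans_none (q : N.Live) (l : L) :
    (some q, l, none) ∈ (N.safeAut h).trans ↔ ∃ q' ∈ N.final, (q.1, l, q') ∈ N.trans := by
  simp only [safeAut, Set.mem_union, Set.mem_ofPred_eq, Prod.mk.injEq, Option.some.injEq,
    reduceCtorEq, and_false, false_and, exists_false, or_false, false_or, and_true]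
  constructor
  · rintro ⟨_, _, h, rfl, rfl⟩
    exact h
  · exact fun h => ⟨q, l, h, rfl, rfl⟩

/-- Redirection already puts such a transition into `Relax_FG`, so only `N` matters. A redirected
transition that coincides with an added self-loop or an original transition counts as rejecting. -/
theorem mem_relaxRej {q q' : N.Live} {l : L} :
    (q, l, q') ∈ N.relaxRej h ↔
      q' = (N.relaxFG h).init ∧ ∃ q'' ∈ N.final, (q.1, l, q'') ∈ N.trans := by
  rw [← mem_safeAut_trans_none N h]
  constructor
  · exact fun hr => ⟨hr.2.1, hr.2.2⟩
  · exact fun ⟨h₁, h₂⟩ => ⟨Or.inr ⟨h₁, Or.inl h₂⟩, h₁, h₂⟩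

theorem relaxRej_subset : N.relaxRej h ⊆ (N.relaxFG h).trans := fun _ ht => ht.1

theorem mem_relaxFG_of_mem_trans {q q' : N.Live} {l : L} (hq : (q.1, l, q'.1) ∈ N.trans) :
    (q, l, q') ∈ (N.relaxFG h).trans :=
  Or.inl (Or.inl ((mem_safeAut_trans_some N h q q' l).2 hq))

/-- The added self-loops and the redirected transitions all lead to the initial state. -/
theorem mem_trans_of_mem_relaxFG {q q' : N.Live} {l : L} (hq : (q, l, q') ∈ (N.relaxFG h).trans)
    (hq' : q' ≠ (N.relaxFG h).init) : (q.1, l, q'.1) ∈ N.trans := by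
  rcases hq with (hq | ⟨l', -, hq⟩) | ⟨hq, -⟩
  · exact (mem_safeAut_trans_some N h q q' l).1 hq
  · simp only [safeAut, Prod.mk.injEq, Option.some.injEq] at hq
    exact absurd hq.2.2 hq'
  · exact absurd hq hq'

/-- The automaton `Relax_FG` can always stay in its initial state. -/
theorem relaxFG_init_loop {l : L} (hl : ∃ q, (N.init, l, q) ∈ N.trans) :
    ((N.relaxFG h).init, l, (N.relaxFG h).init) ∈ (N.relaxFG h).trans := by
  obtain ⟨q, hq⟩ := hl
  by_cases hqf : q ∈ N.final
  · exact (N.relaxRej_subset h) ((mem_relaxRej N h).2 ⟨rfl, q, hqf, hq⟩)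
  · exact Or.inl (Or.inr ⟨l, ⟨some ⟨q, hqf⟩, by simp,
      (mem_safeAut_trans_some N h ⟨N.init, h⟩ ⟨q, hqf⟩ l).2 hq⟩, rfl⟩)

end Relax

section Detect

variable {P : Type*} {N : Automaton (Set P) Q} {f : LTL P}

/-- A run of `Relax_FG` from its initial state that ends with a rejecting transition contains a bad
prefix. -/
theorem DetectsBadPrefixes.exists_not_sat (hN : N.DetectsBadPrefixes f) (h : N.init ∉ N.final)
    {w : ℕ → Set P} {p : ℕ → N.Live} {k m : ℕ} (hkm : k ≤ m) (hk : p k = (N.relaxFG h).init)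
    (hp : ∀ i, k ≤ i → i < m → (p i, w i, p (i + 1)) ∈ (N.relaxFG h).trans)
    (hm : (p m, w m, p (m + 1)) ∈ N.relaxRej h) :
    ∃ l, k ≤ l ∧ ¬ LTL.Sat (LTL.suffix w l) f := by
  classical
  -- The last visit to the initial state up to time `m`. Transitions between `l` and `m` then avoid
  -- the initial state as target, so they belong to `N`; the rejecting one at `m` becomes a step of
  -- `N` into an accepting state.
  let l := Nat.findGreatest (fun i => p i = (N.relaxFG h).init) m
  have hl : p l = (N.relaxFG h).init :=
    Nat.findGreatest_spec (P := fun i => p i = (N.relaxFG h).init) hkm hk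
  have hkl : k ≤ l := Nat.le_findGreatest hkm hk
  have hlm : l ≤ m := Nat.findGreatest_le m
  have hlast : ∀ i, l < i → i ≤ m → p i ≠ (N.relaxFG h).init :=
    fun i hi him => Nat.findGreatest_is_greatest hi him
  refine ⟨l, hkl, ?_⟩
  obtain ⟨q, hqf, hq⟩ := ((mem_relaxRej N h).1 hm).2
  have hacc : N.AcceptsFinite ((List.range (m - l + 1)).map (LTL.suffix w l)) := by
    rw [acceptsFinite_map_range]
    refine ⟨fun i => if i ≤ m - l then (p (l + i)).1 else q, ?_, fun i hi => ?_, ?_⟩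
    · simp [hl, relaxFG]
    · by_cases hi' : i = m - l
      · subst hi'
        simpa [LTL.suffix, Nat.add_sub_cancel' hlm] using hq
      · have h1 : i ≤ m - l := by omega
        have h2 : i + 1 ≤ m - l := by omega
        simp only [h1, h2, if_true]
        exact mem_trans_of_mem_relaxFG N h (hp _ (by omega) (by omega))
          (hlast _ (by omega) (by omega))
    · simpa using hqf
  have := hN.1 _ hacc (LTL.suffix (LTL.suffix w l) (m - l + 1))
  rwa [appendWord_suffix] at this

end Detect

section Ranked

variable {I O S : Type*} {N : Automaton (Letter I O) Q} {f : LTL (I ⊕ O)}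
  {T : TransitionSystem I O S}

/-- Along a trace with a violating suffix, the rank of the initial state of `Relax_FG`
eventually increases. -/
theorem DetectsBadPrefixes.exists_ranking_lt (hN : N.DetectsBadPrefixes f)
    (h : N.init ∉ N.final) (hN₁ : ∀ l, ∃ q, (N.init, l, q) ∈ N.trans)
    {B : S → N.Live → Prop} {μ : S → N.Live → ℕ}
    (hann : IsRanking T (N.relaxFG h).trans (N.relaxRej h) B μ)
    {s : ℕ → S} {w : ℕ → Letter I O} (hs : ∀ i, T.step (s i) (w i).inp = (s (i + 1), (w i).out))
    {t k : ℕ} (htk : t ≤ k) (hB : B (s t) (N.relaxFG h).init)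
    (hbad : ¬ LTL.Sat (LTL.suffix w k) f) :
    ∃ t', t < t' ∧ B (s t') (N.relaxFG h).init ∧
      μ (s t) (N.relaxFG h).init < μ (s t') (N.relaxFG h).init := by
  classical
  -- Staying in the initial state until the violation keeps the rank from dropping.
  have hstay : ∀ k, t ≤ k → B (s k) (N.relaxFG h).init ∧
      μ (s t) (N.relaxFG h).init ≤ μ (s k) (N.relaxFG h).init := by
    intro k htk
    induction k, htk using Nat.le_induction with
    | base => exact ⟨hB, le_rfl⟩
    | succ k _ ih =>
      have := hann _ _ _ _ _ ih.1 (relaxFG_init_loop N h (hN₁ (w k))) (hs k)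
      exact ⟨this.1, ih.2.trans this.2.1⟩
  obtain ⟨n, hn⟩ := hN.2 _ hbad
  obtain ⟨r, hr0, hr, hrf⟩ := (acceptsFinite_map_range N _ n).1 hn
  -- Up to its first accepting state, at `m + 1`, the run lives in `Relax_FG`; the transition into
  -- that state is the redirected one.
  have hex : ∃ i, r i ∈ N.final := ⟨n, hrf⟩
  obtain ⟨m, hm⟩ : ∃ m, Nat.find hex = m + 1 :=
    Nat.exists_eq_succ_of_ne_zero fun h0 => h (by
      have := Nat.find_spec hex
      rwa [h0, hr0] at this)
  have hlive : ∀ i, i ≤ m → r i ∉ N.final := fun i hi => Nat.find_min hex (by omega)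
  have hfin : r (m + 1) ∈ N.final := hm ▸ Nat.find_spec hex
  have hmn : m + 1 ≤ n := hm ▸ Nat.find_min' hex hrf
  have hrun : ∀ i (hi : i ≤ m), B (s (k + i)) ⟨r i, hlive i hi⟩ ∧
      μ (s t) (N.relaxFG h).init ≤ μ (s (k + i)) ⟨r i, hlive i hi⟩ := by
    intro i
    induction i with
    | zero =>
      intro hi
      have : (⟨r 0, hlive 0 hi⟩ : N.Live) = (N.relaxFG h).init := Subtype.ext hr0
      rw [this]
      exact hstay k htk
    | succ i ih =>
      intro hi
      obtain ⟨h1, h2⟩ := ih (by omega)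
      have := hann _ _ _ _ _ h1 (mem_relaxFG_of_mem_trans N h (q' := ⟨r (i + 1), hlive _ hi⟩)
        (hr i (by omega))) (hs (k + i))
      exact ⟨this.1, h2.trans this.2.1⟩
  obtain ⟨h1, h2⟩ := hrun m le_rfl
  have hrej : ((⟨r m, hlive m le_rfl⟩ : N.Live), w (k + m), (N.relaxFG h).init) ∈ N.relaxRej h :=
    (mem_relaxRej N h).2 ⟨rfl, _, hfin, hr m (by omega)⟩
  have := hann _ _ _ _ _ h1 (N.relaxRej_subset h hrej) (hs (k + m))
  exact ⟨k + m + 1, by omega, this.1, h2.trans_lt (this.2.2 hrej)⟩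

/-- Infinitely many violations would push the rank of the initial state above every bound. -/
theorem DetectsBadPrefixes.models_finally_globally (hN : N.DetectsBadPrefixes f)
    (h : N.init ∉ N.final) (hN₁ : ∀ l, ∃ q, (N.init, l, q) ∈ N.trans)
    {B : S → N.Live → Prop} {μ : S → N.Live → ℕ}
    (hann : IsRanking T (N.relaxFG h).trans (N.relaxRej h) B μ)
    {c : ℕ} (hc : ∀ s q, μ s q ≤ c) (hB : B T.init (N.relaxFG h).init) :
    T.Models f.globally.finally_ := by
  rintro w ⟨s, hs0, hs⟩
  by_contra hw
  simp only [LTL.sat_finally_globally, not_exists, not_forall] at hw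
  have key : ∀ n, ∃ t, B (s t) (N.relaxFG h).init ∧ n ≤ μ (s t) (N.relaxFG h).init := by
    intro n
    induction n with
    | zero => exact ⟨0, hs0 ▸ hB, Nat.zero_le _⟩
    | succ n ih =>
      obtain ⟨t, hBt, hn⟩ := ih
      obtain ⟨k, htk, hbad⟩ := hw t
      obtain ⟨t', -, hB', hlt⟩ := hN.exists_ranking_lt h hN₁ hann hs htk hBt hbad
      exact ⟨t', hB', by omega⟩
  obtain ⟨t, -, ht⟩ := key (c + 1)
  have := hc (s t) (N.relaxFG h).init
  omega

/-- The rank starts at its maximum, leaving no room for the increase that a violation forces. -/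
theorem DetectsBadPrefixes.models_globally (hN : N.DetectsBadPrefixes f)
    (h : N.init ∉ N.final) (hN₁ : ∀ l, ∃ q, (N.init, l, q) ∈ N.trans)
    {B : S → N.Live → Prop} {μ : S → N.Live → ℕ}
    (hann : IsRanking T (N.relaxFG h).trans (N.relaxRej h) B μ)
    {c : ℕ} (hc : ∀ s q, μ s q ≤ c) (hB : B T.init (N.relaxFG h).init)
    (hinit : μ T.init (N.relaxFG h).init = c) : T.Models f.globally := by
  rintro w ⟨s, hs0, hs⟩
  rw [LTL.sat_globally]
  intro k
  by_contra hbad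
  obtain ⟨t', -, -, hlt⟩ :=
    hN.exists_ranking_lt h hN₁ hann hs (Nat.zero_le k) (hs0 ▸ hB) hbad
  rw [hs0, hinit] at hlt
  exact absurd (hc (s t') (N.relaxFG h).init) (by omega)

/-- If `T` satisfies `G f`, no rejecting transition of `Relax_FG` is reachable. -/
theorem DetectsBadPrefixes.not_mem_relaxRej (hN : N.DetectsBadPrefixes f) (h : N.init ∉ N.final)
    (hT : T.Models f.globally) {s s' : S} {q q' : N.Live} {l : Letter I O}
    (hreach : ReflTransGen (runStep T (N.relaxFG h).trans) (T.init, (N.relaxFG h).init) (s, q))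
    (hstep : T.step s l.inp = (s', l.out)) : (q, l, q') ∉ N.relaxRej h := by
  intro hrej
  obtain ⟨n, p, w, hp0, hpn, hp⟩ := exists_path_of_reflTransGen hreach
  -- The rejecting edge is appended to the finite path; what follows it is immaterial.
  let w' : ℕ → Letter I O := fun i => if i < n then w i else l
  let p' : ℕ → S × N.Live := fun i => if i ≤ n then p i else (s', q')
  have hp' : ∀ i, i < n + 1 → ((p' i).2, w' i, (p' (i + 1)).2) ∈ (N.relaxFG h).trans ∧
      T.step (p' i).1 (w' i).inp = ((p' (i + 1)).1, (w' i).out) := by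
    intro i hi
    rcases Nat.lt_succ_iff_lt_or_eq.1 hi with hi | rfl
    · simp only [p', w', hi, hi.le, Nat.succ_le_of_lt hi, if_true]
      exact hp i hi
    · simp only [p', w', le_rfl, lt_irrefl, Nat.not_succ_le_self, if_true, if_false, hpn]
      exact ⟨N.relaxRej_subset h hrej, hstep⟩
  have hp'0 : p' 0 = (T.init, (N.relaxFG h).init) := by simp [p', hp0]
  -- As `T` is deterministic, running it on these inputs reproduces the finite path, which thereby
  -- extends to an infinite trace.
  let ι : ℕ → Set I := fun i => (w' i).inp
  have hrun : ∀ i, i ≤ n + 1 → T.run ι i = (p' i).1 := by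
    intro i
    induction i with
    | zero => intro _; rw [hp'0]; rfl
    | succ i ih =>
      intro hi
      simp only [TransitionSystem.run, ih (by omega), ι, (hp' i hi).2]
  have htrace : ∀ i, i < n + 1 → T.traceOf ι i = w' i := by
    intro i hi
    simp only [TransitionSystem.traceOf, hrun i hi.le, ι, (hp' i hi).2, Letter.mk_inp_out]
  obtain ⟨k, -, hk⟩ := hN.exists_not_sat h (w := T.traceOf ι) (p := fun i => (p' i).2)
    (Nat.zero_le n) (by simp only [hp'0])
    (fun i _ hi => by rw [htrace i (by omega)]; exact (hp' i (by omega)).1)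
    (by
      rw [htrace n (by omega)]
      simpa [p', w', hpn] using hrej)
  exact hk ((LTL.sat_globally _ _).1 (hT _ (T.traceOf_mem ι)) k)

/-- On the reachable nodes strictness is never required, so any constant is a ranking. -/
theorem DetectsBadPrefixes.exists_isRanking_globally (hN : N.DetectsBadPrefixes f)
    (h : N.init ∉ N.final) (hT : T.Models f.globally) (c : ℕ) :
    ∃ B : S → N.Live → Prop, IsRanking T (N.relaxFG h).trans (N.relaxRej h) B (fun _ _ => c) ∧
      B T.init (N.relaxFG h).init :=
  ⟨fun s q => ReflTransGen (runStep T (N.relaxFG h).trans) (T.init, (N.relaxFG h).init) (s, q),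
    fun _ _ l _ _ hB hD hstep => ⟨hB.tail ⟨l, hD, hstep⟩, le_rfl,
      fun hR => absurd hR (hN.not_mem_relaxRej h hT hB hstep)⟩, .refl⟩

/-- Every rejecting transition leads to the initial state, so only one marked node per system state
is needed. -/
theorem DetectsBadPrefixes.exists_isRanking_finally_globally [Fintype S] [Fintype Q]
    (hN : N.DetectsBadPrefixes f) (h : N.init ∉ N.final) (hT : T.Models f.globally.finally_) :
    ∃ (B : S → N.Live → Prop) (μ : S → N.Live → ℕ),
      IsRanking T (N.relaxFG h).trans (N.relaxRej h) B μ ∧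
      (∀ s q, μ s q ≤ Fintype.card S) ∧ B T.init (N.relaxFG h).init := by
  classical
  refine ⟨_, _, isRanking_markedRank T (N.relaxFG h).trans (N.relaxRej h)
    (Set.univ ×ˢ {(N.relaxFG h).init}) (T.init, (N.relaxFG h).init)
    (fun q l q' s' _ hR => ⟨trivial, hR.2.1⟩) ?_, fun s q => ?_, .refl⟩
  · intro s q l s' q' hD hR hstep hreach hback
    obtain ⟨p, hp0, hp, hinf⟩ := exists_path_through_edge hreach ⟨l, hD, hstep⟩ hback
    -- Run-graph edges may carry several letters; on the repeated edge the letter must be `l`, the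
    -- one whose transition is rejecting.
    have hw : ∀ i, ∃ x : Letter I O, ((p i).2, x, (p (i + 1)).2) ∈ (N.relaxFG h).trans ∧
        T.step (p i).1 x.inp = ((p (i + 1)).1, x.out) ∧
        (p i = (s, q) → p (i + 1) = (s', q') → x = l) := by
      intro i
      by_cases hi : p i = (s, q) ∧ p (i + 1) = (s', q')
      · exact ⟨l, by rw [hi.1, hi.2]; exact ⟨hD, hstep, fun _ _ => rfl⟩⟩
      · obtain ⟨x, h1, h2⟩ := hp i
        exact ⟨x, h1, h2, fun h3 h4 => absurd ⟨h3, h4⟩ hi⟩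
    choose w hwD hwT hwl using hw
    have hrejs : ∀ k, ∃ i, k ≤ i ∧ ((p i).2, w i, (p (i + 1)).2) ∈ N.relaxRej h := by
      intro k
      obtain ⟨i, hi, h1, h2⟩ := hinf k
      refine ⟨i, hi, ?_⟩
      rw [hwl i h1 h2, h1, h2]
      exact hR
    have hsat := hT w ⟨fun i => (p i).1, by simp only [hp0], hwT⟩
    obtain ⟨k, hk⟩ := (LTL.sat_finally_globally w f).1 hsat
    obtain ⟨i, hki, hi⟩ := hrejs k
    obtain ⟨m, him, hm⟩ := hrejs (i + 1)
    -- The rejecting transition at `i` ends in the initial state, so the segment up to the next one,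
    -- at `m`, contains a bad prefix.
    obtain ⟨j, hj, hbad⟩ := hN.exists_not_sat h (p := fun i => (p i).2) him hi.2.1
      (fun i _ _ => hwD i) hm
    exact hbad (hk j (by omega))
  · refine (markedRank_le_ncard _ _ _).trans_eq ?_
    rw [Set.ncard_prod, Set.ncard_univ, Nat.card_eq_fintype_card, Set.ncard_singleton, mul_one]

end Ranked

end Automaton

/-! ### Meaning of the constraints -/

section Constraints

variable {I O V Q : Type*} {b : ℕ} (a : V → Bool)

/-- Exactly one disjunct can be true: the one for the output valuation that `a` prescribes. -/
theorem holds_letterForm [Fintype O] (out : O → Fin b → Set I → V) (L : Set (Letter I O))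
    (s : Fin b) (i : Set I) : (letterForm out L s i).Holds a ↔ Letter.mk i {p | a (out p s i) = true} ∈ L := by
  classical
  have key : ∀ o : Set O, (PForm.bigAnd Finset.univ fun p =>
      if p ∈ o then PForm.var (out p s i) else PForm.neg (PForm.var (out p s i))).Holds a
      ↔ o = {p | a (out p s i) = true} := by
    intro o
    rw [PForm.holds_bigAnd, Set.ext_iff]
    refine ⟨fun h p => ?_, fun h p _ => ?_⟩
    · have := h p (Finset.mem_univ p)
      split_ifs at this with hp
      · exact iff_of_true hp this
      · exact iff_of_false hp this
    · have := h p
      split_ifs with hp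
      · exact this.1 hp
      · exact fun hc => hp (this.2 hc)
  unfold letterForm
  rw [PForm.holds_bigOr]
  constructor
  · rintro ⟨o, ho, h⟩
    rw [← (key o).1 h]
    exact (Finset.mem_filter.1 ho).2
  · exact fun h => ⟨_, Finset.mem_filter.2 ⟨Finset.mem_univ _, h⟩, (key _).2 rfl⟩

theorem holds_deltaForm [Fintype O] (out : O → Fin b → Set I → V) (D : Set (Q × Letter I O × Q))
    (s : Fin b) (q : Q) (i : Set I) (q' : Q) : (deltaForm out D s q i q').Holds a ↔
      (q, Letter.mk i {p | a (out p s i) = true}, q') ∈ D :=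
  holds_letterForm a out _ s i

theorem holds_tauConstraint [Fintype I] (tau : Fin b → Set I → Fin b → V) :
    (tauConstraint tau).Holds a ↔ ∀ s i, ∃ s', a (tau s i s') = true := by
  simp [tauConstraint, PForm.Holds]

theorem holds_edgeConstraint [Fintype I] [Fintype O] [Fintype Q]
    (tau : Fin b → Set I → Fin b → V) (out : O → Fin b → Set I → V)
    (D : Set (Q × Letter I O × Q)) (lamB : Fin b → Q → V)
    (succ : Fin b → Q → Fin b → Q → Set I → PForm V) :
    (edgeConstraint tau out D lamB succ).Holds a ↔ ∀ q q' s s' i, a (lamB s q) = true →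
      (q, Letter.mk i {p | a (out p s i) = true}, q') ∈ D → a (tau s i s') = true →
      (succ s q s' q' i).Holds a := by
  simp [edgeConstraint, PForm.Holds, holds_deltaForm]

theorem holds_succCoBuchi {K : ℕ} (F : Set Q) (lamB : Fin b → Q → V)
    (lamN : Fin b → Q → Fin K → V) (s : Fin b) (q : Q) (s' : Fin b) (q' : Q) :
    (succCoBuchi F lamB lamN s q s' q').Holds a ↔ a (lamB s' q') = true ∧
      PForm.number a (fun k => .var (lamN s q k)) ≤ PForm.number a (fun k => .var (lamN s' q' k)) ∧
      (q' ∈ F → PForm.number a (fun k => .var (lamN s q k)) <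
        PForm.number a (fun k => .var (lamN s' q' k))) := by
  unfold succCoBuchi
  split_ifs with h
  · simp only [PForm.Holds, PForm.holds_bitsGt, h, true_imp_iff]
    exact and_congr_right fun _ => ⟨fun h => ⟨h.le, h⟩, fun h => h.2⟩
  · simp [PForm.Holds, PForm.holds_bitsGe, h]

theorem holds_succFG [Fintype O] {K : ℕ} (out : O → Fin b → Set I → V)
    (R : Set (Q × Letter I O × Q))
    (lamB : Fin b → Q → V) (lamN : Fin b → Q → Fin K → V)
    (s : Fin b) (q : Q) (s' : Fin b) (q' : Q) (i : Set I) :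
    (succFG out R lamB lamN s q s' q' i).Holds a ↔ a (lamB s' q') = true ∧
      PForm.number a (fun k => .var (lamN s q k)) ≤ PForm.number a (fun k => .var (lamN s' q' k)) ∧
      ((q, Letter.mk i {p | a (out p s i) = true}, q') ∈ R →
        PForm.number a (fun k => .var (lamN s q k)) <
          PForm.number a (fun k => .var (lamN s' q' k))) := by
  simp only [succFG, PForm.Holds, PForm.holds_imp, PForm.holds_bitsGt, PForm.holds_bitsGe,
    holds_deltaForm]
  refine and_congr_right fun _ => ⟨fun h => ⟨?_, h.1⟩, fun h => ⟨h.2, fun _ => h.1⟩⟩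
  by_cases hR : (q, Letter.mk i {p | a (out p s i) = true}, q') ∈ R
  · exact (h.1 hR).le
  · exact h.2 hR

theorem holds_boundConstraint [Fintype Q] {K c : ℕ} (hc : c < 2 ^ K) (lamN : Fin b → Q → Fin K → V) :
    (boundConstraint lamN c).Holds a ↔
      ∀ s q, PForm.number a (fun k => .var (lamN s q k)) ≤ c := by
  simp [boundConstraint, PForm.holds_bitsGe, PForm.number_constBits a hc]

/-- The values of the ranking variables that satisfy the edge constraints form a ranking of
each system that complies with the values of `tau` and `out`. -/
theorem isRanking_of_holds [Fintype I] [Fintype O] [Fintype Q]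
    {tau : Fin b → Set I → Fin b → V} {out : O → Fin b → Set I → V}
    {D R : Set (Q × Letter I O × Q)} {lamB : Fin b → Q → V} {f : Fin b → Q → ℕ}
    {succ : Fin b → Q → Fin b → Q → Set I → PForm V}
    (hsucc : ∀ s q s' q' i, (succ s q s' q' i).Holds a → a (lamB s' q') = true ∧
      f s q ≤ f s' q' ∧
      ((q, Letter.mk i {p | a (out p s i) = true}, q') ∈ R → f s q < f s' q'))
    (h : (edgeConstraint tau out D lamB succ).Holds a) {T : TransitionSystem I O (Fin b)}
    (hT : ∀ s i, a (tau s i (T.step s i).1) = true ∧ (T.step s i).2 = {o | a (out o s i) = true}) :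
    IsRanking T D R (fun s q => a (lamB s q) = true) f := by
  intro s q l s' q' hB hD hstep
  obtain ⟨h1, h2⟩ := hT s l.inp
  rw [hstep] at h1 h2
  have hl : Letter.mk l.inp {o | a (out o s l.inp) = true} = l := by
    rw [← h2, Letter.mk_inp_out]
  have := hsucc _ _ _ _ _ ((holds_edgeConstraint a _ _ _ _ _).1 h q q' s s' l.inp hB
    (by rwa [hl]) h1)
  rwa [hl] at this

/-- Here `tau` offers only the successor chosen by `T`, so the constraints speak only of run-graph
edges. -/
theorem holds_of_isRanking [Fintype I] [Fintype O] [Fintype Q]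
    {tau : Fin b → Set I → Fin b → V} {out : O → Fin b → Set I → V}
    {D R : Set (Q × Letter I O × Q)} {lamB : Fin b → Q → V} {f : Fin b → Q → ℕ}
    {succ : Fin b → Q → Fin b → Q → Set I → PForm V}
    (hsucc : ∀ s q s' q' i, (a (lamB s' q') = true ∧ f s q ≤ f s' q' ∧
      ((q, Letter.mk i {p | a (out p s i) = true}, q') ∈ R → f s q < f s' q')) →
      (succ s q s' q' i).Holds a)
    {T : TransitionSystem I O (Fin b)}
    (htau : ∀ s i s', a (tau s i s') = true → (T.step s i).1 = s')
    (hout : ∀ s i, (T.step s i).2 = {o | a (out o s i) = true})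
    (h : IsRanking T D R (fun s q => a (lamB s q) = true) f) :
    (edgeConstraint tau out D lamB succ).Holds a :=
  (holds_edgeConstraint a _ _ _ _ _).2 fun q q' s s' i hB hD hs' =>
    hsucc _ _ _ _ _ (h s q _ s' q' hB hD
      (Prod.ext (by simpa using htau s i s' hs') (by simpa using hout s i)))

end Constraints

/-! ### Optimal assignments and the instance -/

/-- Weights are bounded by the sum of all soft weights, so the supremum is attained, even with
infinitely many variables. -/
theorem MaxSAT.exists_isOptimal {V : Type*} (M : MaxSAT V) (h : ∃ a, M.Feasible a) :
    ∃ a, M.IsOptimal a := by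
  classical
  have hbound : ∀ a, M.weight a ≤ (M.soft.map Prod.snd).sum := fun a =>
    List.sum_le_sum fun c _ => by split_ifs <;> simp
  obtain ⟨a₀, h₀⟩ := h
  let W : Set ℕ := {m | ∃ a, M.Feasible a ∧ M.weight a = m}
  have hW : BddAbove W := ⟨_, by rintro _ ⟨a, -, rfl⟩; exact hbound a⟩
  obtain ⟨a, ha, hmax⟩ := Nat.sSup_mem (s := W) ⟨_, a₀, h₀, rfl⟩ hW
  exact ⟨a, ha, fun a' ha' => hmax ▸ le_csSup hW ⟨a', ha', rfl⟩⟩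

section Encoding

variable {I O Q : Type*} [Fintype I] [Fintype O] [Fintype Q] {n : ℕ}
  {QN QH : Fin n → Type*} [∀ j, Fintype (QN j)] [∀ j, Fintype (QH j)]
  {A : Automaton (Letter I O) Q} {N : ∀ j, Automaton (Letter I O) (QN j)}
  {hN : ∀ j, (N j).init ∉ (N j).final} {H : ∀ j, Automaton (Letter I O) (QH j)}
  {b : ℕ} [NeZero b]

open Classical in
theorem feasible_mrEncoding_iff (a : MRVar A N H b → Bool) :
    (mrEncoding A N hN H b).Feasible a ↔
      (tauConstraint (fun s i s' => EncVar.tau s i s')).Holds a ∧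
      a (.hardB 0 A.init) = true ∧
      (edgeConstraint (fun s i s' => .tau s i s') (fun o s i => .out o s i) A.trans
          (fun s q => .hardB s q)
          (fun s q s' q' _ => succCoBuchi A.final (fun s q => .hardB s q)
            (fun s q k => .hardN s q k) s q s' q')).Holds a ∧
      (∀ j, (edgeConstraint (fun s i s' => .tau s i s') (fun o s i => .out o s i)
        ((N j).relaxFG (hN j)).trans (fun s q => .fgB j s q)
        (succFG (fun o s i => .out o s i) ((N j).relaxRej (hN j)) (fun s q => .fgB j s q)
          (fun s q k => .fgN j s q k))).Holds a) ∧
      (∀ j s q, PForm.number a (fun k => .var (.fgN j s q k)) ≤ b) ∧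
      (∀ j, (edgeConstraint (fun s i s' => .tau s i s') (fun o s i => .out o s i) (H j).trans
        (fun s q => .gfB j s q)
        (fun s q s' q' _ => succCoBuchi (H j).final (fun s q => .gfB j s q)
          (fun s q k => .gfN j s q k) s q s' q')).Holds a) := by
  have hb := fun j => holds_boundConstraint a (Nat.lt_size_self b)
    (fun s q k => (EncVar.fgN j s q k : MRVar A N H b))
  simp only [← hb]
  simp only [MaxSAT.Feasible, mrEncoding, List.mem_append, List.mem_cons, List.mem_map,
    List.mem_finRange, List.not_mem_nil, or_imp, forall_and, forall_eq, true_and, or_false,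
    forall_exists_index, forall_apply_eq_imp_iff, PForm.Holds, and_assoc]

open Classical in
theorem weight_mrEncoding (a : MRVar A N H b → Bool) :
    (mrEncoding A N hN H b).weight a = ∑ j,
      ((if a (.fgB j 0 ((N j).relaxFG (hN j)).init) = true ∧
          PForm.number a (fun k => .var (.fgN j 0 ((N j).relaxFG (hN j)).init k)) = b
          then 1 else 0) +
        (if a (.fgB j 0 ((N j).relaxFG (hN j)).init) = true then n else 0) +
        (if a (.fgB j 0 ((N j).relaxFG (hN j)).init) = true ∨ a (.gfB j 0 (H j).init) = true
          then n ^ 2 else 0)) := by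
  rw [Fin.sum_univ_def]
  simp only [MaxSAT.weight, mrEncoding, List.map_flatMap]
  generalize List.finRange n = l
  induction l with
  | nil => rfl
  | cons j l ih =>
    rw [List.flatMap_cons, List.sum_append, ih, List.map_cons, List.sum_cons]
    congr 1
    simp [PForm.Holds, PForm.holds_bitsEqConst a _ (Nat.lt_size_self b), add_assoc]
    congr

end Encoding

/-! ### Weights and lexicographic values -/

theorem ite_le_ite_of_imp {p q : Prop} [Decidable p] [Decidable q] (h : p → q) (c : ℕ) :
    (if p then c else 0) ≤ if q then c else 0 := by
  by_cases hp : p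
  · simp [hp, h hp]
  · simp [hp]

theorem sum_indicator_le {n : ℕ} {p q : Fin n → Prop} [DecidablePred p] [DecidablePred q]
    (h : ∀ j, p j → q j) :
    ∑ j, (if p j then 1 else 0) ≤ ∑ j, (if q j then 1 else 0) :=
  Finset.sum_le_sum fun j _ => ite_le_ite_of_imp (h j) 1

/-- For triples bounded by `n` with decreasing entries, the weights `n ^ 2`, `n`, `1` are compatible
with the lexicographic order. -/
theorem lex_le_of_weight_le {n x y z x' y' z' : ℕ} (hxn : x' ≤ n) (hy : y ≤ x)
    (hx' : x ≤ n) (hw : z + n * y + n ^ 2 * x ≤ z' + n * y' + n ^ 2 * x')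
    (hy' : y' ≤ x') (hz' : z' ≤ y') :
    (toLex (x, toLex (y, z)) : ℕ ×ₗ (ℕ ×ₗ ℕ)) ≤ toLex (x', toLex (y', z')) := by
  rw [Prod.Lex.toLex_le_toLex]
  rcases lt_trichotomy x x' with h | h | h
  · exact Or.inl h
  · subst h
    refine Or.inr ⟨rfl, ?_⟩
    rw [Prod.Lex.toLex_le_toLex]
    rcases lt_trichotomy y y' with h | h | h
    · exact Or.inl h
    · subst h
      exact Or.inr ⟨rfl, by simpa using hw⟩
    -- Here `z' ≤ y' < y ≤ n`, so `z'` cannot compensate a loss of `n`.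
    · nlinarith
  -- Here `z' ≤ y' ≤ x' < x ≤ n`, so `n * y' + z'` is at most `n ^ 2 - 1`. Bounding `y'` and `z'` by
  -- `n` alone would not suffice.
  · obtain ⟨m, rfl⟩ : ∃ m, n = m + 1 := ⟨n - 1, by omega⟩
    nlinarith

section Value

variable {I O : Type*} {n : ℕ} {ψ : Fin n → LTL (I ⊕ O)}

open Classical in
/-- The weighted sum of the entries of the value of `T`. -/
noncomputable def TransitionSystem.totalWeight {S : Type*} (T : TransitionSystem I O S)
    (ψ : Fin n → LTL (I ⊕ O)) : ℕ :=
  ∑ j, ((if T.Models (ψ j).globally then 1 else 0) +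
    (if T.Models (ψ j).globally.finally_ then n else 0) +
    (if T.Models (ψ j).finally_.globally then n ^ 2 else 0))

theorem TransitionSystem.valAll_le_valAll {S S' : Type*} {T : TransitionSystem I O S}
    {T' : TransitionSystem I O S'} (h : T.totalWeight ψ ≤ T'.totalWeight ψ) :
    T.valAll ψ ≤ T'.valAll ψ := by
  classical
  have hbound : ∀ p : Fin n → Prop, ∑ j, (if p j then 1 else 0) ≤ n := fun p =>
    (sum_indicator_le (q := fun _ => True) fun _ _ => trivial).trans_eq (by simp)
  have hsum : ∀ (c : ℕ) (p : Fin n → Prop),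
      ∑ j, (if p j then c else 0) = c * ∑ j, (if p j then 1 else 0) := fun c p => by
    simp only [Finset.mul_sum, mul_ite, mul_one, mul_zero]
  simp only [totalWeight, Finset.sum_add_distrib] at h
  rw [hsum n, hsum (n ^ 2), hsum n, hsum (n ^ 2)] at h
  simp only [valAll, val_eq]
  exact lex_le_of_weight_le (hbound _) (sum_indicator_le fun _ => Models.globally_finally)
    (hbound _) h
    (sum_indicator_le fun _ => Models.globally_finally)
    (sum_indicator_le fun _ => Models.finally_globally)

end Value

/-! ### Soundness and completeness of the encoding -/

section Encoding

variable {I O Q : Type*} [Fintype I] [Fintype O] [Fintype Q] {n : ℕ}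
  {QN QH : Fin n → Type*} [∀ j, Fintype (QN j)] [∀ j, Fintype (QH j)]
  {A : Automaton (Letter I O) Q} {N : ∀ j, Automaton (Letter I O) (QN j)}
  {H : ∀ j, Automaton (Letter I O) (QH j)}
  {b : ℕ} [NeZero b] {φ : LTL (I ⊕ O)} {ψ : Fin n → LTL (I ⊕ O)}

/-- An extracted system satisfies what the ranking of a feasible assignment claims. -/
theorem models_of_feasible (hA : A.IsCoBuchiFor φ)
    (hN : ∀ j, (N j).DetectsBadPrefixes (ψ j)) (hN₀ : ∀ j, (N j).init ∉ (N j).final)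
    (hN₁ : ∀ j (l : Letter I O), ∃ q, ((N j).init, l, q) ∈ (N j).trans)
    (hH : ∀ j, (H j).IsCoBuchiFor (ψ j).finally_.globally)
    {a : MRVar A N H b → Bool} (ha : (mrEncoding A N hN₀ H b).Feasible a)
    {T : TransitionSystem I O (Fin b)} (hT : Extracted a T) :
    T.Models φ ∧ ∀ j,
      (a (.fgB j 0 ((N j).relaxFG (hN₀ j)).init) = true →
        T.Models (ψ j).globally.finally_ ∧
        (PForm.number a (fun k => .var (.fgN j 0 ((N j).relaxFG (hN₀ j)).init k)) = b →
          T.Models (ψ j).globally)) ∧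
      (a (.gfB j 0 (H j).init) = true → T.Models (ψ j).finally_.globally) := by
  classical
  obtain ⟨-, hinit, hhard, hfg, hbound, hgf⟩ := (feasible_mrEncoding_iff a).1 ha
  obtain ⟨hT₀, hT⟩ := hT
  refine ⟨?_, fun j => ⟨fun hB => ?_, fun hB => ?_⟩⟩
  · have hann := isRanking_of_holds a (R := A.rejecting)
      (fun s q s' q' i h => (holds_succCoBuchi a _ _ _ _ _ _ _).1 h) hhard hT
    -- The number of bits already bounds these ranks; only `Relax_FG` needs the exact bound `b`.
    exact (hA _ T).1 (A.coBuchiAccepts_of_isRanking hann (hT₀ ▸ hinit)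
      fun s q => (PForm.number_lt a _).le)
  · have hann := isRanking_of_holds a (R := (N j).relaxRej (hN₀ j))
      (fun s q s' q' i h => (holds_succFG a _ _ _ _ _ _ _ _ _).1 h) (hfg j) hT
    exact ⟨(hN j).models_finally_globally (hN₀ j) (hN₁ j) hann (hbound j) (hT₀ ▸ hB),
      fun hb => (hN j).models_globally (hN₀ j) (hN₁ j) hann (hbound j) (hT₀ ▸ hB) (hT₀ ▸ hb)⟩
  · have hann := isRanking_of_holds a (R := (H j).rejecting)
      (fun s q s' q' i h => (holds_succCoBuchi a _ _ _ _ _ _ _).1 h) (hgf j) hT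
    exact (hH j _ T).1 ((H j).coBuchiAccepts_of_isRanking hann (hT₀ ▸ hB)
      fun s q => (PForm.number_lt a _).le)

/-- Each system that satisfies the hard specification gives rise to a feasible assignment whose
ranking claims all relaxations that the system satisfies. -/
theorem exists_feasible_of_models (hA : A.IsCoBuchiFor φ)
    (hN : ∀ j, (N j).DetectsBadPrefixes (ψ j)) (hN₀ : ∀ j, (N j).init ∉ (N j).final)
    (hH : ∀ j, (H j).IsCoBuchiFor (ψ j).finally_.globally)
    {T : TransitionSystem I O (Fin b)} (hT₀ : T.init = 0) (hT : T.Models φ) :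
    ∃ a : MRVar A N H b → Bool, (mrEncoding A N hN₀ H b).Feasible a ∧ ∀ j,
      (T.Models (ψ j).globally → a (.fgB j 0 ((N j).relaxFG (hN₀ j)).init) = true ∧
        PForm.number a (fun k => .var (.fgN j 0 ((N j).relaxFG (hN₀ j)).init k)) = b) ∧
      (T.Models (ψ j).globally.finally_ →
        a (.fgB j 0 ((N j).relaxFG (hN₀ j)).init) = true) ∧
      (T.Models (ψ j).finally_.globally → a (.gfB j 0 (H j).init) = true) := by
  classical
  obtain ⟨B, f, hann, hf, hB⟩ := ((hA _ T).2 hT).exists_isRanking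
  -- The strongest admissible claim is chosen: constant rank `b` under `G`, marked ranks under `FG`
  -- alone, the empty annotation otherwise.
  have hfg : ∀ j, ∃ (B : Fin b → (N j).Live → Prop) (μ : Fin b → (N j).Live → ℕ),
      IsRanking T ((N j).relaxFG (hN₀ j)).trans ((N j).relaxRej (hN₀ j)) B μ ∧
      (∀ s q, μ s q ≤ b) ∧
      (T.Models (ψ j).globally → B 0 ((N j).relaxFG (hN₀ j)).init ∧
        μ 0 ((N j).relaxFG (hN₀ j)).init = b) ∧
      (T.Models (ψ j).globally.finally_ → B 0 ((N j).relaxFG (hN₀ j)).init) := by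
    intro j
    by_cases h₁ : T.Models (ψ j).globally
    · obtain ⟨B, hann, hB⟩ := (hN j).exists_isRanking_globally (hN₀ j) h₁ b
      rw [hT₀] at hB
      exact ⟨B, _, hann, fun _ _ => le_rfl, fun _ => ⟨hB, rfl⟩, fun _ => hB⟩
    · by_cases h₂ : T.Models (ψ j).globally.finally_
      · obtain ⟨B, μ, hann, hμ, hB⟩ := (hN j).exists_isRanking_finally_globally (hN₀ j) h₂
        rw [hT₀] at hB
        exact ⟨B, μ, hann, by simpa using hμ, fun h => absurd h h₁, fun _ => hB⟩
      · exact ⟨_, _, isRanking_false T _ _, fun _ _ => Nat.zero_le _, fun h => absurd h h₁,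
          fun h => absurd h h₂⟩
  have hgf : ∀ j, ∃ (B : Fin b → QH j → Prop) (g : Fin b → QH j → ℕ),
      IsRanking T (H j).trans (H j).rejecting B g ∧
      (∀ s q, g s q ≤ b * (H j).final.ncard) ∧
      (T.Models (ψ j).finally_.globally → B 0 (H j).init) := by
    intro j
    by_cases h : T.Models (ψ j).finally_.globally
    · obtain ⟨B, g, hann, hg, hB⟩ := ((hH j _ T).2 h).exists_isRanking
      rw [hT₀] at hB
      exact ⟨B, g, hann, by simpa using hg, fun _ => hB⟩
    · exact ⟨_, _, isRanking_false T _ _, fun _ _ => Nat.zero_le _, fun h' => absurd h' h⟩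
  choose Bfg μ hannfg hμ hG hFG using hfg
  choose Bgf g hanngf hg hGF using hgf
  rw [hT₀] at hB
  rw [Fintype.card_fin] at hf
  let a : MRVar A N H b → Bool := fun v => match v with
    | .tau s i s' => decide ((T.step s i).1 = s')
    | .out o s i => decide (o ∈ (T.step s i).2)
    | .hardB s q => decide (B s q)
    | .hardN s q k => (f s q).testBit k
    | .fgB j s q => decide (Bfg j s q)
    | .fgN j s q k => (μ j s q).testBit k
    | .gfB j s q => decide (Bgf j s q)
    | .gfN j s q k => (g j s q).testBit k
  have hnhard : ∀ s q, PForm.number a (fun k => .var (.hardN s q k)) = f s q := fun s q =>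
    PForm.number_eq a _ (Nat.lt_two_pow_size_of_le (hf s q)) fun _ => Iff.rfl
  have hnfg : ∀ j s q, PForm.number a (fun k => .var (.fgN j s q k)) = μ j s q := fun j s q =>
    PForm.number_eq a _ (Nat.lt_two_pow_size_of_le (hμ j s q)) fun _ => Iff.rfl
  have hngf : ∀ j s q, PForm.number a (fun k => .var (.gfN j s q k)) = g j s q := fun j s q =>
    PForm.number_eq a _ (Nat.lt_two_pow_size_of_le (hg j s q)) fun _ => Iff.rfl
  have htau : ∀ s i s', a (.tau s i s') = true → (T.step s i).1 = s' := fun s i s' h =>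
    of_decide_eq_true h
  have hout : ∀ s i, (T.step s i).2 = {o | a (.out o s i) = true} := fun s i => by
    ext o
    simp [a]
  refine ⟨a, (feasible_mrEncoding_iff a).2 ⟨?_, decide_eq_true hB, ?_, fun j => ?_,
    fun j s q => (hnfg j s q).trans_le (hμ j s q), fun j => ?_⟩, fun j => ⟨fun h => ?_,
    fun h => decide_eq_true (hFG j h), fun h => decide_eq_true (hGF j h)⟩⟩
  · exact (holds_tauConstraint a _).2 fun s i => ⟨_, decide_eq_true rfl⟩
  · refine holds_of_isRanking a (R := A.rejecting) (f := f) (fun s q s' q' i h => ?_) htau hout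
      (by simpa [a] using hann)
    rw [holds_succCoBuchi, hnhard, hnhard]
    exact h
  · refine holds_of_isRanking a (R := (N j).relaxRej (hN₀ j)) (f := μ j)
      (fun s q s' q' i h => ?_) htau hout (by simpa [a] using hannfg j)
    rw [holds_succFG, hnfg, hnfg]
    exact h
  · refine holds_of_isRanking a (R := (H j).rejecting) (f := g j)
      (fun s q s' q' i h => ?_) htau hout (by simpa [a] using hanngf j)
    rw [holds_succCoBuchi, hngf, hngf]
    exact h
  · exact ⟨decide_eq_true (hG j h).1, (hnfg j _ _).trans (hG j h).2⟩

/-- Claims are true in `T`, but `T` may satisfy more than is claimed, so only an inequality holds.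
-/
theorem weight_le_totalWeight (hA : A.IsCoBuchiFor φ)
    (hN : ∀ j, (N j).DetectsBadPrefixes (ψ j)) (hN₀ : ∀ j, (N j).init ∉ (N j).final)
    (hN₁ : ∀ j (l : Letter I O), ∃ q, ((N j).init, l, q) ∈ (N j).trans)
    (hH : ∀ j, (H j).IsCoBuchiFor (ψ j).finally_.globally)
    {a : MRVar A N H b → Bool} (ha : (mrEncoding A N hN₀ H b).Feasible a)
    {T : TransitionSystem I O (Fin b)} (hT : Extracted a T) :
    (mrEncoding A N hN₀ H b).weight a ≤ T.totalWeight ψ := by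
  have hmod := (models_of_feasible hA hN hN₀ hN₁ hH ha hT).2
  classical
  rw [weight_mrEncoding, TransitionSystem.totalWeight]
  refine Finset.sum_le_sum fun j _ => add_le_add (add_le_add ?_ ?_) ?_
  · exact ite_le_ite_of_imp (fun h => ((hmod j).1 h.1).2 h.2) 1
  · exact ite_le_ite_of_imp (fun h => ((hmod j).1 h).1) n
  · exact ite_le_ite_of_imp
      (fun h => h.elim (fun h => ((hmod j).1 h).1.globally_finally) (hmod j).2) (n ^ 2)

theorem exists_feasible_totalWeight_le (hA : A.IsCoBuchiFor φ)
    (hN : ∀ j, (N j).DetectsBadPrefixes (ψ j)) (hN₀ : ∀ j, (N j).init ∉ (N j).final)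
    (hH : ∀ j, (H j).IsCoBuchiFor (ψ j).finally_.globally)
    {T : TransitionSystem I O (Fin b)} (hT₀ : T.init = 0) (hT : T.Models φ) :
    ∃ a : MRVar A N H b → Bool, (mrEncoding A N hN₀ H b).Feasible a ∧
      T.totalWeight ψ ≤ (mrEncoding A N hN₀ H b).weight a := by
  obtain ⟨a, ha, hval⟩ := exists_feasible_of_models hA hN hN₀ hH hT₀ hT
  refine ⟨a, ha, ?_⟩
  classical
  rw [weight_mrEncoding, TransitionSystem.totalWeight]
  refine Finset.sum_le_sum fun j _ => add_le_add (add_le_add ?_ ?_) ?_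
  · exact ite_le_ite_of_imp (hval j).1 1
  · exact ite_le_ite_of_imp (hval j).2.1 n
  · exact ite_le_ite_of_imp (fun h => Or.inr ((hval j).2.2 h)) (n ^ 2)

theorem exists_extracted {hN₀ : ∀ j, (N j).init ∉ (N j).final} {a : MRVar A N H b → Bool}
    (ha : (mrEncoding A N hN₀ H b).Feasible a) :
    ∃ T : TransitionSystem I O (Fin b), Extracted a T := by
  have htau := (holds_tauConstraint a _).1 ((feasible_mrEncoding_iff a).1 ha).1
  choose next hnext using htau
  exact ⟨⟨0, fun s i => (next s i, {o | a (.out o s i) = true})⟩, rfl,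
    fun s i => ⟨hnext s i, rfl⟩⟩

end Encoding

theorem theorem2 {I O : Type*} [Fintype I] [Fintype O]
    -- hard specification and soft specifications
    {n : ℕ} (φ : LTL (I ⊕ O)) (ψ : Fin n → LTL (I ⊕ O))
    -- universal co-Büchi automaton for the hard specification
    {Q : Type*} [Fintype Q] (A : Automaton (Letter I O) Q) (hA : A.IsCoBuchiFor φ)
    -- finite-word automata detecting the bad prefixes of the soft specifications
    {QN : Fin n → Type*} [∀ j, Fintype (QN j)] (N : ∀ j, Automaton (Letter I O) (QN j))
    (hN : ∀ j, (N j).DetectsBadPrefixes (ψ j))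
    (hN₀ : ∀ j, (N j).init ∉ (N j).final)
    (hN₁ : ∀ j (l : Letter I O), ∃ q, ((N j).init, l, q) ∈ (N j).trans)
    -- universal co-Büchi automata for the relaxations `G F ψ j`
    {QH : Fin n → Type*} [∀ j, Fintype (QH j)] (H : ∀ j, Automaton (Letter I O) (QH j))
    (hH : ∀ j, (H j).IsCoBuchiFor (ψ j).finally_.globally)
    (b : ℕ) [NeZero b] :
    -- the hard constraints are satisfiable iff there is an implementation of size at most `b`
    ((∃ a, (mrEncoding A N hN₀ H b).Feasible a) ↔
      ∃ (S : Type) (_ : Fintype S) (T : TransitionSystem I O S),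
        Fintype.card S ≤ b ∧ T.Models φ) ∧
    -- in that case there is an optimal assignment
    ((∃ a, (mrEncoding A N hN₀ H b).Feasible a) →
      ∃ a, (mrEncoding A N hN₀ H b).IsOptimal a) ∧
    -- from each optimal assignment one can extract a transition system, and each extracted
    -- transition system is an optimal implementation
    ∀ a, (mrEncoding A N hN₀ H b).IsOptimal a →
      (∃ T : TransitionSystem I O (Fin b), Extracted a T) ∧
      ∀ T' : TransitionSystem I O (Fin b), Extracted a T' →
        T'.Models φ ∧
        ∀ (S : Type) [Fintype S] (T : TransitionSystem I O S),
          Fintype.card S ≤ b → T.Models φ → T.valAll ψ ≤ T'.valAll ψ := by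

  refine ⟨⟨?_, ?_⟩, MaxSAT.exists_isOptimal _, fun a ha => ⟨exists_extracted ha.1, fun T' hT' =>
    ⟨(models_of_feasible hA hN hN₀ hN₁ hH ha.1 hT').1, fun S _ T hS hT => ?_⟩⟩⟩
  · rintro ⟨a, ha⟩
    obtain ⟨T, hT⟩ := exists_extracted ha
    exact ⟨Fin b, inferInstance, T, (Fintype.card_fin b).le,
      (models_of_feasible hA hN hN₀ hN₁ hH ha hT).1⟩
  · rintro ⟨S, _, T, hS, hT⟩
    obtain ⟨T₁, hT₁, htr⟩ := T.exists_fin_traces_eq hS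
    obtain ⟨a, ha, -⟩ := exists_feasible_totalWeight_le hA hN hN₀ hH hT₁
      (fun w hw => hT w (htr ▸ hw))
    exact ⟨a, ha⟩
  · obtain ⟨T₁, hT₁, htr⟩ := T.exists_fin_traces_eq hS
    obtain ⟨a₁, ha₁, hle⟩ := exists_feasible_totalWeight_le hA hN hN₀ hH hT₁
      (fun w hw => hT w (htr ▸ hw))
    have hval : T.valAll ψ = T₁.valAll ψ := by
      simp only [TransitionSystem.valAll, TransitionSystem.val_congr htr]
    rw [hval]
    -- Optimality of `a` is applied against the assignment `a₁` built from the competitor.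
    exact TransitionSystem.valAll_le_valAll
      (hle.trans ((ha.2 a₁ ha₁).trans (weight_le_totalWeight hA hN hN₀ hN₁ hH ha.1 hT')))
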